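/- Theorem. Let $k$ be a field (of arbitrary characteristic), let $s\ge 0$ be an integer, and let $P=k[X_1,X_2,X_3,Y_1,\dots,Y_s]$ be the standard-graded polynomial ring in $3+s$ variables. Let $B'$ be an ideal of $P$ generated by five linearly independent quadratic forms in $X_1,X_2,X_3$, let $B''=(Y_1,\dots,Y_s)$, and let $B=B'+B''$. Let $A$ be a homogeneous ideal of $P$ which is contained in the fifth power of the ideal generated by the forms of degree one, and assume that $P/A$ is an Artinian Gorenstein local ring. Assume that the socle of $P/B$ (the set of elements annihilated by all forms of degree one) contains no nonzero element of degree one. Let $R=P/(A:_PB)$, where $(A:_PB)=\{p\in P\mid pB\subseteq A\}$; this is an Artinian local ring. Let $\omega_R$ be the canonical module of $R$, that is, the injective hull of the residue field of $R$. Then every second syzygy module of $\omega_R$, that is, every $R$-module $Z$ for which there is an exact sequence of $R$-modules $0\to Z\to F_2\to F_1\to\omega_R\to 0$ with $F_1,F_2$ projective, has a direct summand isomorphic, as an $R$-module, to $B'/BB'$ (in particular, $A:_PB$ annihilates $B'/BB'$). -/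

import Mathlib

open MvPolynomial

universe u v

section LocalAlgebra

/-- A Gorenstein local ring: a Noetherian local ring whose injective dimension, as a module
over itself, is finite. -/
structure IsGorensteinLocalRing (S : Type u) [CommRing S] : Prop where
  isLocalRing : IsLocalRing S
  isNoetherianRing : IsNoetherianRing S
  finite_injectiveDimension :
    ∃ n : ℕ, CategoryTheory.HasInjectiveDimensionLE (ModuleCat.of S S) n

/-- `ω` is a canonical module of the Artinian local ring `R`: an injective hull of the residue
field of `R`, that is, an injective module which is an essential extension of a copy of the
residue field. -/
structure IsCanonicalModule (R : Type u) [CommRing R] [IsLocalRing R] [IsArtinianRing R]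
    (ω : Type u) [AddCommGroup ω] [Module R ω] : Prop where
  injective : Module.Injective R ω
  essential : ∃ ι : IsLocalRing.ResidueField R →ₗ[R] ω, Function.Injective ι ∧
    ∀ N : Submodule R ω, N ≠ ⊥ → N ⊓ LinearMap.range ι ≠ ⊥

/-- `Z` is a second syzygy module of `M`: there is an exact sequence
`0 → Z → F₂ → F₁ → M → 0` with `F₁` and `F₂` projective. -/
def IsSecondSyzygy (R : Type u) [CommRing R] (Z M : Type u)
    [AddCommGroup Z] [Module R Z] [AddCommGroup M] [Module R M] : Prop :=
  ∃ (F₂ F₁ : Type u) (_ : AddCommGroup F₂) (_ : Module R F₂)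
    (_ : AddCommGroup F₁) (_ : Module R F₁) (i : Z →ₗ[R] F₂) (d : F₂ →ₗ[R] F₁) (e : F₁ →ₗ[R] M),
    Module.Projective R F₂ ∧ Module.Projective R F₁ ∧
      Function.Injective i ∧ Function.Exact i d ∧ Function.Exact d e ∧ Function.Surjective e

/-- For an ideal `J` of `P`, the `P ⧸ J`-module `Z` has a direct summand isomorphic to the
`P`-module `T`. The isomorphism is a bijective additive map `f : T → N` with
`f (p • t) = [p] • f t`; its existence forces `J` to annihilate `T`, and then it is the same as an
isomorphism of `P ⧸ J`-modules. -/
def HasDirectSummandIso {P : Type u} [CommRing P] (J : Ideal P) (Z : Type u) [AddCommGroup Z]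
    [Module (P ⧸ J) Z] (T : Type u) [AddCommGroup T] [Module P T] : Prop :=
  ∃ N N' : Submodule (P ⧸ J) Z, IsCompl N N' ∧
    ∃ f : T →ₛₗ[Ideal.Quotient.mk J] N, Function.Bijective f

end LocalAlgebra

section Graded

variable {σ : Type v} {k : Type u} [Field k]

/-- The ideal of the standard-graded polynomial ring generated by the forms of degree one. -/
noncomputable def maxHomogIdeal (σ : Type v) (k : Type u) [Field k] : Ideal (MvPolynomial σ k) :=
  Ideal.span (homogeneousSubmodule σ k 1 : Set (MvPolynomial σ k))

/-- Homogeneous ideals of the standard-graded polynomial ring: the homogeneous components of every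
element belong to the ideal. -/
def IsHomogIdeal (I : Ideal (MvPolynomial σ k)) : Prop :=
  ∀ f ∈ I, ∀ i : ℕ, homogeneousComponent i f ∈ I

/-- The degree `i` component of the quotient by a (homogeneous) ideal `I`: the residue classes of
the forms of degree `i`. -/
noncomputable def quotientPiece (I : Ideal (MvPolynomial σ k)) (i : ℕ) :
    Submodule k (MvPolynomial σ k ⧸ I) :=
  (homogeneousSubmodule σ k i).map (Ideal.Quotient.mkₐ k I).toLinearMap

/-- The socle of the quotient by `I`: the elements annihilated by the maximal homogeneous ideal. -/
def quotientSocle (I : Ideal (MvPolynomial σ k)) : Set (MvPolynomial σ k ⧸ I) :=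
  {x | ∀ p ∈ maxHomogIdeal σ k, Ideal.Quotient.mk I p * x = 0}

end Graded

section Setting

variable {k : Type u} [Field k] (s : ℕ)

/-- The polynomial ring `k[X₁,X₂,X₃,Y₁,…,Y_s]`; the `X`'s are the variables `Sum.inl i` and the
`Y`'s are the variables `Sum.inr j`. -/
abbrev PolyXY (k : Type u) [Field k] (s : ℕ) : Type u := MvPolynomial (Fin 3 ⊕ Fin s) k

/-- The ideal `B'` of `k[X₁,X₂,X₃,Y₁,…,Y_s]` generated by polynomials `q₁,…,q₅` in
`k[X₁,X₂,X₃]`. -/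
noncomputable def idealX (q : Fin 5 → MvPolynomial (Fin 3) k) : Ideal (PolyXY k s) :=
  Ideal.span (Set.range fun i => rename Sum.inl (q i))

/-- The ideal `B'' = (Y₁,…,Y_s)`. -/
noncomputable def idealY (k : Type u) [Field k] (s : ℕ) : Ideal (PolyXY k s) :=
  Ideal.span (Set.range fun j : Fin s => X (Sum.inr j))

end Setting

/-!
Write `P = k[X₀, X₁, X₂, Y₁, …, Y_s]`, `Q = k[X₀, X₁, X₂]` and `R = P ⧸ J` with `J = A : B`.

*Normal form.* The five quadrics span the kernel of a functional `ψ` on the quadratic forms of `Q`.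
The socle hypothesis says that the symmetric bilinear form `(u, v) ↦ ψ (u * v)` on the linear forms
is nondegenerate. On a space of dimension three such a form is diagonalizable in every
characteristic (`exists_orthogonal_triple`: an alternating form in odd dimension is degenerate).
So a linear substitution turns the quadrics into
`X₁X₂, X₀X₂, X₀X₁, aX₀² - X₁², cX₀² - X₂²` with `a, c ≠ 0` (`quadForm`), and `B'` modulo `Y` becomes
the annihilator `quadIdeal a c` of `quadFun a c`, the extension of `ψ` by zero
(`mem_quadIdeal_iff`).

*Duality.* `P ⧸ A` is self-injective, so `A` is the annihilator of a functional `φ` on `P`, and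
every functional which vanishes on `A` is of the form `p ↦ φ (x * p)` (`exists_dual_functional`).
Hence `ω ≃ B ⧸ A` (`IsCanonicalModule.exists_presentation`). As `A` lies in the fifth power of the
maximal homogeneous ideal, functionals of `Q` supported in degrees at most four are of this form.
In particular there is `w` with `φ (w * p) = ψ p`; then `A : w = B` and `J = A + (w)`.

*The summand.* Let `G = P ^ (5 + s)`, mapping onto `B` by the generators of `B`, let `N` be the
preimage of `A`, and let `G₀` be the kernel of the projection `G → B' ⧸ BB'`. The degree bound on
`A` gives `N ≤ G₀`. With `E = N ⧸ (A G + w G₀)`, multiplication by `w` gives an exact sequence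
`0 → B' ⧸ BB' → E → G ⧸ J G → ω → 0`. The map `B' ⧸ BB' → E` factors through a map
`B' ⧸ BB' → R ^ 5` with image in `𝔪 R ^ 5`: the map `R ^ 5 → E` is given by five linear syzygies of
the quadrics (`linSyz`), and the map `B' ⧸ BB' → R ^ 5` by elements of `P` dual to explicit cubic
functionals (`cubicFun`), which satisfy the identities `sum_cubicFun_linSyz_mul` and
`cubicFun_quadForm_mul`. Comparing the exact sequence with `0 → Z → F₂ → F₁ → ω → 0` yields maps
`B' ⧸ BB' → Z → B' ⧸ BB'` whose composite is the identity up to a map which factors through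
`B' ⧸ BB' → 𝔪 R ^ 5`. By Nakayama the composite is bijective
(`IsSecondSyzygy.exists_retraction`), so `B' ⧸ BB'` is a direct summand of `Z`.
-/

/-! ### Artinian Gorenstein local rings are self-injective -/

section SelfInjective

open CategoryTheory Abelian

/-- A nonzero module over an Artinian local ring contains a copy of the residue field. -/
theorem IsArtinianRing.exists_socle_element (S : Type u) [CommRing S] [IsLocalRing S]
    [IsArtinianRing S] (M : Type u) [AddCommGroup M] [Module S M] [Nontrivial M] :
    ∃ z : M, z ≠ 0 ∧ ∀ r : S, r • z = 0 ↔ r ∈ IsLocalRing.maximalIdeal S := by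
  obtain ⟨p, hp⟩ := associatedPrimes.nonempty S M
  have hmax : p.IsMaximal := IsArtinianRing.isPrime_iff_isMaximal p |>.1 hp.isPrime
  obtain rfl := IsLocalRing.eq_maximalIdeal hmax
  obtain ⟨-, z, hz⟩ := isAssociatedPrime_iff.1 hp
  have hz' (r : S) : r • z = 0 ↔ r ∈ IsLocalRing.maximalIdeal S := by
    rw [hz, Submodule.mem_colon_singleton, Submodule.mem_bot]
  refine ⟨z, ?_, hz'⟩
  rintro rfl
  exact hmax.ne_top ((Ideal.eq_top_iff_one _).2 ((hz' 1).1 (smul_zero _)))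

/-- A vector space over the residue field embeds in a free module, since `S` has nonzero socle. -/
theorem exists_injective_to_free_of_torsion {S : Type u} [CommRing S] [IsLocalRing S]
    [IsArtinianRing S] {Y : Type u} [AddCommGroup Y] [Module S Y]
    (hY : ∀ r ∈ IsLocalRing.maximalIdeal S, ∀ y : Y, r • y = 0) :
    ∃ (ι : Type u) (f : Y →ₗ[S] (ι →₀ S)), Function.Injective f := by
  have hT : Module.IsTorsionBySet S Y (IsLocalRing.maximalIdeal S : Set S) :=
    fun y r => hY r.1 r.2 y
  let _ : Module (S ⧸ IsLocalRing.maximalIdeal S) Y := hT.module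
  let _ : Field (S ⧸ IsLocalRing.maximalIdeal S) := Ideal.Quotient.field _
  have : IsScalarTower S (S ⧸ IsLocalRing.maximalIdeal S) Y := hT.isScalarTower
  obtain ⟨z, hz, hzm⟩ := IsArtinianRing.exists_socle_element S S
  let b := Module.Basis.ofVectorSpace (S ⧸ IsLocalRing.maximalIdeal S) Y
  let g : (S ⧸ IsLocalRing.maximalIdeal S) →ₗ[S] S :=
    Submodule.liftQ _ (LinearMap.toSpanSingleton S S z) (fun r hr => by
      simpa using (hzm r).2 hr)
  have hg : Function.Injective g := by
    rw [← LinearMap.ker_eq_bot]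
    refine Submodule.ker_liftQ_eq_bot _ _ _ (fun r hr => (hzm r).1 (by simpa using hr))
  refine ⟨_, (Finsupp.mapRange.linearMap g).comp
    (b.repr.toLinearMap.restrictScalars S), ?_⟩
  exact (Finsupp.mapRange_injective _ (map_zero g) hg).comp b.repr.injective

/-- Embedding the residue field in a free module shifts `Ext` up by one degree, so the top `Ext`
into a module of finite injective dimension vanishes on vector spaces over the residue field. -/
theorem ext_subsingleton_of_torsion {S : Type u} [CommRing S] [IsLocalRing S]
    [IsArtinianRing S] (M : ModuleCat.{u} S) (n : ℕ) (h : HasInjectiveDimensionLT M (n + 2))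
    {Y : Type u} [AddCommGroup Y] [Module S Y]
    (hY : ∀ r ∈ IsLocalRing.maximalIdeal S, ∀ y : Y, r • y = 0) :
    Subsingleton (Ext (ModuleCat.of S Y) M (n + 1)) := by
  obtain ⟨ι, f, hf⟩ := exists_injective_to_free_of_torsion hY
  let C : ShortComplex (ModuleCat.{u} S) :=
    ModuleCat.shortComplexOfCompEqZero _ _ f.exact_map_mkQ_range.linearMap_comp_eq_zero
  have hC : C.ShortExact := ModuleCat.shortComplex_shortExact C
      f.exact_map_mkQ_range hf (Submodule.mkQ_surjective _)
  have hproj : Projective C.X₂ :=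
    (IsProjective.iff_projective (R := S) (ι →₀ S)).1 inferInstance
  refine subsingleton_of_forall_eq 0 fun x => ?_
  obtain ⟨y, rfl⟩ := Ext.contravariant_sequence_exact₁ hC M (n₀ := n + 1) (n₁ := n + 2) x
    (by omega) (Ext.eq_zero_of_hasInjectiveDimensionLT _ (n + 2) le_rfl)
  rw [Ext.eq_zero_of_projective y, Ext.comp_zero]

/-- The vanishing of `Ext` passes from vector spaces over the residue field to all modules killed by
a power of the maximal ideal. -/
theorem ext_subsingleton_of_pow_torsion {S : Type u} [CommRing S] [IsLocalRing S]
    [IsArtinianRing S] (M : ModuleCat.{u} S) (n : ℕ) (h : HasInjectiveDimensionLT M (n + 2))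
    (i : ℕ) (Y : Type u) [AddCommGroup Y] [Module S Y]
    (hY : ∀ r ∈ IsLocalRing.maximalIdeal S ^ i, ∀ y : Y, r • y = 0) :
    Subsingleton (Ext (ModuleCat.of S Y) M (n + 1)) := by
  induction i generalizing Y with
  | zero =>
    exact ext_subsingleton_of_torsion M n h fun r _ y => by
      have h1 := hY 1 (by simp) y
      rw [one_smul] at h1
      rw [h1, smul_zero]
  | succ i ih =>
    let N : Submodule S Y := IsLocalRing.maximalIdeal S • ⊤
    let C : ShortComplex (ModuleCat.{u} S) :=
      ModuleCat.shortComplexOfCompEqZero _ _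
        (LinearMap.exact_subtype_mkQ N).linearMap_comp_eq_zero
    have hC : C.ShortExact := ModuleCat.shortComplex_shortExact C
      (LinearMap.exact_subtype_mkQ N) N.injective_subtype (Submodule.mkQ_surjective _)
    have h₁ : Subsingleton (Ext C.X₁ M (n + 1)) := ih N fun r hr y => by
      obtain ⟨y, hy⟩ := y
      ext
      refine Submodule.smul_induction_on (p := fun y => r • y = 0) hy (fun m hm y _ => ?_)
        (fun y y' h h' => by rw [smul_add, h, h', add_zero])
      rw [smul_smul]
      exact hY _ (by rw [pow_succ]; exact Ideal.mul_mem_mul hr hm) y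
    have h₃ : Subsingleton (Ext C.X₃ M (n + 1)) :=
      ext_subsingleton_of_torsion (Y := Y ⧸ N) M n h fun r hr y => by
        obtain ⟨y, rfl⟩ := N.mkQ_surjective y
        rw [← map_smul]
        exact (Submodule.Quotient.mk_eq_zero N).2 (Submodule.smul_mem_smul hr trivial)
    refine subsingleton_of_forall_eq 0 fun x => ?_
    obtain ⟨y, rfl⟩ := Ext.contravariant_sequence_exact₂ hC M (n := n + 1) x
      (Subsingleton.elim _ _)
    rw [Subsingleton.elim y 0, Ext.comp_zero]

/-- Over an Artinian local ring a module of finite injective dimension is injective. -/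
theorem injective_of_hasInjectiveDimensionLT {S : Type u} [CommRing S] [IsLocalRing S]
    [IsArtinianRing S] (M : ModuleCat.{u} S) (n : ℕ) (h : HasInjectiveDimensionLT M (n + 1)) :
    Injective M := by
  induction n with
  | zero => exact injective_iff_hasInjectiveDimensionLT_one.2 h
  | succ n ih =>
    refine ih (hasInjectiveDimensionLT_of_enoughProjectives M (n + 1) fun Y => ?_)
    obtain ⟨i, hi⟩ := (isArtinianRing_iff_isNilpotent_maximalIdeal S).1 inferInstance
    refine ext_subsingleton_of_pow_torsion M n h i Y fun r hr y => ?_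
    rw [hi] at hr
    rw [show r = 0 from hr, zero_smul]

/-- An Artinian Gorenstein local ring is self-injective. -/
theorem IsGorensteinLocalRing.injective_self {S : Type u} [CommRing S] [IsLocalRing S]
    [IsArtinianRing S] (h : IsGorensteinLocalRing S) : Module.Injective S S := by
  obtain ⟨n, hn⟩ := h.finite_injectiveDimension
  have := injective_of_hasInjectiveDimensionLT _ n hn
  exact Module.injective_module_of_injective_object S S

end SelfInjective

/-! ### Perfect functionals on self-injective algebras -/

section Functional

/-- In a self-injective local ring any two nonzero elements of the socle generate each other. -/
theorem exists_mul_eq_of_injective_self {S : Type u} [CommRing S] [IsLocalRing S]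
    (hinj : Module.Injective S S) {y z : S}
    (hz : ∀ r, r * z = 0 ↔ r ∈ IsLocalRing.maximalIdeal S)
    (hy : ∀ r ∈ IsLocalRing.maximalIdeal S, r * y = 0) : ∃ c, y = c * z := by
  let g (x : S) (hx : ∀ r ∈ IsLocalRing.maximalIdeal S, r * x = 0) :
      (S ⧸ IsLocalRing.maximalIdeal S) →ₗ[S] S :=
    Submodule.liftQ _ (LinearMap.toSpanSingleton S S x) (fun r hr => by
      simpa using hx r hr)
  have hg : Function.Injective (g z fun r hr => (hz r).2 hr) := by
    rw [← LinearMap.ker_eq_bot]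
    refine Submodule.ker_liftQ_eq_bot _ _ _ (fun r hr => (hz r).1 (by simpa using hr))
  obtain ⟨h, hh⟩ := hinj.out _ hg (g y hy)
  refine ⟨h 1, ?_⟩
  have := hh (Submodule.Quotient.mk 1)
  simp only [g, Submodule.liftQ_apply, LinearMap.toSpanSingleton_apply, one_smul] at this
  rw [← this, ← mul_one z, ← smul_eq_mul z 1, map_smul, smul_eq_mul, smul_eq_mul, mul_one, mul_comm]

/-- A self-injective Artinian local algebra of finite dimension over `k` carries a `k`-linear
functional whose associated bilinear form `(x, y) ↦ φ (x * y)` is perfect. -/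
theorem exists_perfect_functional (k : Type u) [Field k] (S : Type u) [CommRing S] [Algebra k S]
    [IsLocalRing S] [IsArtinianRing S] [Module.Finite k S] (hinj : Module.Injective S S) :
    ∃ φ : S →ₗ[k] k, (∀ x, (∀ y, φ (x * y) = 0) → x = 0) ∧
      ∀ l : S →ₗ[k] k, ∃ x, ∀ y, l y = φ (x * y) := by
  obtain ⟨z, hz0, hz⟩ := IsArtinianRing.exists_socle_element S S
  obtain ⟨φ, hφ⟩ : ∃ φ : S →ₗ[k] k, φ z ≠ 0 := by
    by_contra! h
    exact hz0 ((Module.forall_dual_apply_eq_zero_iff k z).1 h)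
  -- A nonzero ideal contains a socle element, hence `z`, on which `φ` does not vanish.
  have hnd : ∀ x, (∀ y, φ (x * y) = 0) → x = 0 := by
    intro x hx
    by_contra hx0
    have : Nontrivial (Ideal.span {x}) :=
      Submodule.nontrivial_iff_ne_bot.2 (by simpa using hx0)
    obtain ⟨⟨y, hy⟩, hy0, hym⟩ := IsArtinianRing.exists_socle_element S (Ideal.span {x})
    obtain ⟨r, rfl⟩ := Ideal.mem_span_singleton'.1 hy
    obtain ⟨c, hc⟩ := exists_mul_eq_of_injective_self (y := z) (z := r * x) hinj
      (fun s => by rw [← hym s, Subtype.ext_iff]; rfl)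
      (fun s hs => (hz s).2 hs)
    exact hφ (by rw [hc, ← mul_assoc, mul_comm, hx])
  refine ⟨φ, hnd, ?_⟩
  let β : S →ₗ[k] Module.Dual k S := (LinearMap.mul k S).compr₂ φ
  have hβ : Function.Injective β := by
    rw [← LinearMap.ker_eq_bot, LinearMap.ker_eq_bot']
    intro x hx
    exact hnd x fun y => by simpa [β] using LinearMap.congr_fun hx y
  have hβ' : Function.Surjective β :=
    (LinearMap.injective_iff_surjective_of_finrank_eq_finrank
      (Subspace.dual_finrank_eq (K := k) (V := S)).symm).1 hβ
  intro l
  obtain ⟨x, hx⟩ := hβ' l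
  exact ⟨x, fun y => by rw [← hx]; rfl⟩

end Functional

/-! ### The quadrics in normal form and their dual functionals -/

section Explicit

variable {k : Type u} [Field k]

/-- The functional on `k[X₀, X₁, X₂]` reading off the coefficient of `X₀ ^ l * X₁ ^ m * X₂ ^ n`. -/
noncomputable def coeffFun (k : Type u) [Field k] (l m n : ℕ) : MvPolynomial (Fin 3) k →ₗ[k] k :=
  lcoeff k (Finsupp.single 0 l + Finsupp.single 1 m + Finsupp.single 2 n)

variable (l m n : ℕ) (p : MvPolynomial (Fin 3) k)

theorem coeffFun_X_zero_mul : coeffFun k (l + 1) m n (X 0 * p) = coeffFun k l m n p := by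
  simp only [coeffFun, lcoeff_apply, Finsupp.single_add]
  rw [← coeff_X_mul (Finsupp.single 0 l + Finsupp.single 1 m + Finsupp.single 2 n) 0 p]
  congr 1; abel

theorem coeffFun_X_one_mul : coeffFun k l (m + 1) n (X 1 * p) = coeffFun k l m n p := by
  simp only [coeffFun, lcoeff_apply, Finsupp.single_add]
  rw [← coeff_X_mul (Finsupp.single 0 l + Finsupp.single 1 m + Finsupp.single 2 n) 1 p]
  congr 1; abel

theorem coeffFun_X_two_mul : coeffFun k l m (n + 1) (X 2 * p) = coeffFun k l m n p := by
  simp only [coeffFun, lcoeff_apply, Finsupp.single_add]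
  rw [← coeff_X_mul (Finsupp.single 0 l + Finsupp.single 1 m + Finsupp.single 2 n) 2 p]
  congr 1; abel

theorem coeffFun_zero_X_zero_mul : coeffFun k 0 m n (X 0 * p) = 0 := by
  classical
  simp [coeffFun, coeff_X_mul']

theorem coeffFun_zero_X_one_mul : coeffFun k l 0 n (X 1 * p) = 0 := by
  classical
  simp [coeffFun, coeff_X_mul']

theorem coeffFun_zero_X_two_mul : coeffFun k l m 0 (X 2 * p) = 0 := by
  classical
  simp [coeffFun, coeff_X_mul']

theorem coeffFun_C_mul (a : k) : coeffFun k l m n (C a * p) = a * coeffFun k l m n p := by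
  simp [coeffFun]

variable (a c : k)

/-- The functional `ψ`, whose bilinear form on the linear forms is diagonal with entries
`1, a, c` and which vanishes on the forms of any degree other than two. -/
noncomputable def quadFun : MvPolynomial (Fin 3) k →ₗ[k] k :=
  coeffFun k 2 0 0 + a • coeffFun k 0 2 0 + c • coeffFun k 0 0 2

/-- The five quadratic forms spanning the kernel of `quadFun a c` in degree two. -/
noncomputable def quadForm : Fin 5 → MvPolynomial (Fin 3) k :=
  ![X 1 * X 2, X 0 * X 2, X 0 * X 1, C a * (X 0 * X 0) - X 1 * X 1, C c * (X 0 * X 0) - X 2 * X 2]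

/-- Five linear syzygies of `quadForm a c`; the first index numbers the syzygies. -/
noncomputable def linSyz : Fin 5 → Fin 5 → MvPolynomial (Fin 3) k :=
  ![![0, C a * X 2, -(C c * X 1), -(C c * X 0), C a * X 0],
    ![-X 2, 0, C c * X 0, 0, -X 1],
    ![X 1, -(C a * X 0), 0, X 2, 0],
    ![X 0, -X 1, 0, 0, 0],
    ![X 0, 0, -X 2, 0, 0]]

/-- A matrix of functionals supported in degree three which inverts the matrix of syzygies
`linSyz a c` up to the functional `quadFun a c`. -/
noncomputable def cubicFun : Fin 5 → Fin 5 → (MvPolynomial (Fin 3) k →ₗ[k] k) :=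
  ![![0, 0, -(a * c⁻¹) • coeffFun k 0 3 0, 0,
      (a⁻¹ * c) • coeffFun k 1 0 2 + a⁻¹ • coeffFun k 3 0 0],
    ![-c • coeffFun k 0 0 3, 0, c⁻¹ • coeffFun k 3 0 0, 0, -a • coeffFun k 0 3 0],
    ![0, 0, 0, c • coeffFun k 0 0 3 + a • coeffFun k 0 2 1 + coeffFun k 2 0 1,
      (a⁻¹ * c ^ 2) • coeffFun k 0 0 3 + (a⁻¹ * c) • coeffFun k 2 0 1],
    ![0, -c • coeffFun k 0 1 2 - a • coeffFun k 0 3 0 - coeffFun k 2 1 0, 0,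
      -a • coeffFun k 1 1 1, 0],
    ![a • coeffFun k 1 2 0 + coeffFun k 3 0 0, a • coeffFun k 0 3 0 + coeffFun k 2 1 0,
      -c • coeffFun k 0 0 3, 0, 0]]

/-- The companion of `cubicFun` in the exchange identity `cubicFun_quadForm_mul`. -/
noncomputable def cubicFun' : Fin 5 → Fin 5 → (MvPolynomial (Fin 3) k →ₗ[k] k) :=
  ![![0, -(a⁻¹ * c) • coeffFun k 0 0 3, 0,
      (a * c⁻¹) • coeffFun k 1 2 0 + c⁻¹ • coeffFun k 3 0 0, 0],
    ![0, 0, 0, (a ^ 2 * c⁻¹) • coeffFun k 0 3 0 + (a * c⁻¹) • coeffFun k 2 1 0,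
      c • coeffFun k 0 1 2 + a • coeffFun k 0 3 0 + coeffFun k 2 1 0],
    ![-a • coeffFun k 0 3 0, a⁻¹ • coeffFun k 3 0 0, 0, -c • coeffFun k 0 0 3, 0],
    ![-c • coeffFun k 1 0 2 - coeffFun k 3 0 0, a • coeffFun k 0 3 0,
      -c • coeffFun k 0 0 3 - coeffFun k 2 0 1, 0, 0],
    ![0, 0, c • coeffFun k 0 0 3 + a • coeffFun k 0 2 1 + coeffFun k 2 0 1, 0,
      c • coeffFun k 1 1 1]]

theorem sum_linSyz_mul_quadForm (j : Fin 5) :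
    ∑ i, linSyz a c j i * quadForm a c i = 0 := by
  fin_cases j <;> simp [linSyz, quadForm, Fin.sum_univ_five] <;> ring

variable {a c}

/-- The functionals `cubicFun a c` invert the syzygy matrix up to `quadFun a c`. Through duality
this factors multiplication by `w` on `B' ⧸ BB'` through the syzygies. -/
theorem sum_cubicFun_linSyz_mul (ha : a ≠ 0) (hc : c ≠ 0) (i l : Fin 5)
    (p : MvPolynomial (Fin 3) k) :
    ∑ j, cubicFun a c j l (linSyz a c j i * p) = if i = l then quadFun a c p else 0 := by
  have h : ∀ i l : Fin 5, ∑ j, cubicFun a c j l (linSyz a c j i * p) =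
      (![![quadFun a c p, 0, 0, 0, 0], ![0, quadFun a c p, 0, 0, 0],
        ![0, 0, quadFun a c p, 0, 0], ![0, 0, 0, quadFun a c p, 0],
        ![0, 0, 0, 0, quadFun a c p]] : Fin 5 → Fin 5 → k) i l := by
    intro i l
    fin_cases i <;> fin_cases l <;>
    simp only [Fin.sum_univ_five, linSyz, cubicFun, quadFun, Fin.reduceFinMk, Fin.zero_eta,
    Fin.mk_one, Fin.isValue, Matrix.cons_val, mul_assoc, neg_mul, map_neg, LinearMap.add_apply,
    LinearMap.sub_apply, LinearMap.smul_apply, LinearMap.zero_apply, smul_eq_mul, mul_zero,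
    sub_zero, zero_sub, add_zero, zero_add, zero_mul, map_zero, neg_zero, coeffFun_X_zero_mul,
    coeffFun_X_one_mul, coeffFun_X_two_mul, coeffFun_zero_X_zero_mul, coeffFun_zero_X_one_mul,
    coeffFun_zero_X_two_mul, coeffFun_C_mul] <;>
    field_simp <;> ring
  rw [h]
  fin_cases i <;> fin_cases l <;> rfl

-- The identity is checked on each of the 125 triples of indices.
set_option maxHeartbeats 1000000 in
/-- The exchange identity: summed against the coefficients of a relation `∑ uᵢ bᵢ ∈ (b) ^ 2` between
the quadrics `bᵢ`, the functionals `cubicFun a c j` vanish on the ideal of the quadrics. -/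
theorem cubicFun_quadForm_mul (ha : a ≠ 0) (hc : c ≠ 0) (j i l : Fin 5)
    (p : MvPolynomial (Fin 3) k) :
    cubicFun a c j i (quadForm a c l * p) = cubicFun' a c j l (quadForm a c i * p) := by
  fin_cases j <;> fin_cases i <;> fin_cases l <;>
  simp only [quadForm, cubicFun, cubicFun', Fin.reduceFinMk, Fin.zero_eta, Fin.mk_one, Fin.isValue,
    Matrix.cons_val, mul_assoc, sub_mul, map_sub, LinearMap.add_apply,
    LinearMap.sub_apply, LinearMap.smul_apply, LinearMap.zero_apply, smul_eq_mul, mul_zero,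
    sub_zero, zero_sub, add_zero, zero_add, coeffFun_X_zero_mul,
    coeffFun_X_one_mul, coeffFun_X_two_mul, coeffFun_zero_X_zero_mul, coeffFun_zero_X_one_mul,
    coeffFun_zero_X_two_mul, coeffFun_C_mul] <;>
  field_simp <;> ring

end Explicit

/-! ### The ideal of the quadrics in normal form -/

section QuadIdeal

variable {k : Type u} [Field k]

theorem coeffFun_eq_zero_of_mem_pow {l m n d : ℕ} (h : l + m + n < d)
    {p : MvPolynomial (Fin 3) k} (hp : p ∈ idealOfVars (Fin 3) k ^ d) : coeffFun k l m n p = 0 := by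
  refine (mem_pow_idealOfVars_iff' d p).1 hp _ ?_
  simpa [map_add, Finsupp.degree_single] using h

theorem coeffFun_C (l m n : ℕ) (r : k) :
    coeffFun k l m n (C r) = if l = 0 ∧ m = 0 ∧ n = 0 then r else 0 := by
  have : (0 : Fin 3 →₀ ℕ) = Finsupp.single 0 l + Finsupp.single 1 m + Finsupp.single 2 n ↔
      l = 0 ∧ m = 0 ∧ n = 0 := by
    constructor
    · intro h
      exact ⟨by simpa using (DFunLike.congr_fun h 0).symm,
        by simpa using (DFunLike.congr_fun h 1).symm, by simpa using (DFunLike.congr_fun h 2).symm⟩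
    · rintro ⟨rfl, rfl, rfl⟩
      simp
  classical
  simp [coeffFun, coeff_C, this]

variable (a c : k)

theorem quadFun_eq_zero_of_mem_pow {p : MvPolynomial (Fin 3) k}
    (hp : p ∈ idealOfVars (Fin 3) k ^ 3) : quadFun a c p = 0 := by
  have h (l m n : ℕ) (hd : l + m + n < 3) : coeffFun k l m n p = 0 :=
    coeffFun_eq_zero_of_mem_pow hd hp
  simp [quadFun, h]

theorem cubicFun_eq_zero_of_mem_pow (i j : Fin 5) {p : MvPolynomial (Fin 3) k}
    (hp : p ∈ idealOfVars (Fin 3) k ^ 4) : cubicFun a c i j p = 0 := by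
  have h (l m n : ℕ) (hd : l + m + n < 4) : coeffFun k l m n p = 0 :=
    coeffFun_eq_zero_of_mem_pow hd hp
  fin_cases i <;> fin_cases j <;>
  simp only [cubicFun, Fin.reduceFinMk, Fin.zero_eta, Fin.mk_one, Fin.isValue, Matrix.cons_val,
    LinearMap.add_apply, LinearMap.sub_apply, LinearMap.smul_apply, LinearMap.zero_apply, h,
    Nat.reduceAdd, Nat.reduceLT, smul_zero, add_zero, sub_zero]

theorem cubicFun'_eq_zero_of_mem_pow (i j : Fin 5) {p : MvPolynomial (Fin 3) k}
    (hp : p ∈ idealOfVars (Fin 3) k ^ 4) : cubicFun' a c i j p = 0 := by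
  have h (l m n : ℕ) (hd : l + m + n < 4) : coeffFun k l m n p = 0 :=
    coeffFun_eq_zero_of_mem_pow hd hp
  fin_cases i <;> fin_cases j <;>
  simp only [cubicFun', Fin.reduceFinMk, Fin.zero_eta, Fin.mk_one, Fin.isValue, Matrix.cons_val,
    LinearMap.add_apply, LinearMap.sub_apply, LinearMap.smul_apply, LinearMap.zero_apply, h,
    Nat.reduceAdd, Nat.reduceLT, smul_zero, add_zero, sub_zero]

/-- The ideal of `k[X₀, X₁, X₂]` generated by the quadratic forms `quadForm a c`. -/
noncomputable def quadIdeal : Ideal (MvPolynomial (Fin 3) k) :=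
  Ideal.span (Set.range (quadForm a c))

theorem quadForm_mem (i : Fin 5) : quadForm a c i ∈ quadIdeal a c :=
  Ideal.subset_span ⟨i, rfl⟩

theorem X_mul_X_sub_mem (i j : Fin 3) :
    (X i * X j - if i = j then C ((![1, a, c] : Fin 3 → k) i) * (X 0 * X 0) else 0 :
      MvPolynomial (Fin 3) k) ∈ quadIdeal a c := by
  have h0 : (X 1 * X 2 : MvPolynomial (Fin 3) k) ∈ quadIdeal a c := quadForm_mem a c 0
  have h1 : (X 0 * X 2 : MvPolynomial (Fin 3) k) ∈ quadIdeal a c := quadForm_mem a c 1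
  have h2 : (X 0 * X 1 : MvPolynomial (Fin 3) k) ∈ quadIdeal a c := quadForm_mem a c 2
  have h3 : (C a * (X 0 * X 0) - X 1 * X 1 : MvPolynomial (Fin 3) k) ∈ quadIdeal a c :=
    quadForm_mem a c 3
  have h4 : (C c * (X 0 * X 0) - X 2 * X 2 : MvPolynomial (Fin 3) k) ∈ quadIdeal a c :=
    quadForm_mem a c 4
  rw [← neg_mem_iff, neg_sub] at h3 h4
  fin_cases i <;> fin_cases j <;> simp [h0, h1, h2, h3, h4, mul_comm (X 2 : MvPolynomial (Fin 3) k),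
    mul_comm (X 1 : MvPolynomial (Fin 3) k) (X 0)]

theorem X_mul_X_mem {i j : Fin 3} (h : i ≠ j) :
    (X i * X j : MvPolynomial (Fin 3) k) ∈ quadIdeal a c := by
  simpa [h] using X_mul_X_sub_mem a c i j

theorem X_mem_idealOfVars (i : Fin 3) :
    (X i : MvPolynomial (Fin 3) k) ∈ idealOfVars (Fin 3) k :=
  Ideal.subset_span ⟨i, rfl⟩

variable {a c}

theorem idealOfVars_pow_three_le (ha : a ≠ 0) :
    idealOfVars (Fin 3) k ^ 3 ≤ idealOfVars (Fin 3) k * quadIdeal a c := by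
  have hK {i : Fin 3} {q : MvPolynomial (Fin 3) k} (hq : q ∈ quadIdeal a c) :
      X i * q ∈ idealOfVars (Fin 3) k * quadIdeal a c :=
    Ideal.mul_mem_mul (X_mem_idealOfVars i) hq
  have hcube (i : Fin 3) : (X i * (X i * X i) : MvPolynomial (Fin 3) k) ∈
      idealOfVars (Fin 3) k * quadIdeal a c := by
    have h10 : (X 1 * X 0 : MvPolynomial (Fin 3) k) ∈ quadIdeal a c := X_mul_X_mem a c (by decide)
    have h20 : (X 2 * X 0 : MvPolynomial (Fin 3) k) ∈ quadIdeal a c := X_mul_X_mem a c (by decide)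
    have h3 : (X 1 * X 1 - C a * (X 0 * X 0) : MvPolynomial (Fin 3) k) ∈ quadIdeal a c := by
      simpa using X_mul_X_sub_mem a c 1 1
    have h4 : (X 2 * X 2 - C c * (X 0 * X 0) : MvPolynomial (Fin 3) k) ∈ quadIdeal a c := by
      simpa using X_mul_X_sub_mem a c 2 2
    fin_cases i
    · have : (X 0 * (X 0 * X 0) : MvPolynomial (Fin 3) k) =
          C a⁻¹ * (X 1 * (X 1 * X 0) - X 0 * (X 1 * X 1 - C a * (X 0 * X 0))) := by
        have e : (C a⁻¹ * C a : MvPolynomial (Fin 3) k) = 1 := by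
          rw [← C_mul, inv_mul_cancel₀ ha, C_1]
        linear_combination (- (X 0 * (X 0 * X 0))) * e
      simp only [Fin.zero_eta]
      rw [this]
      exact Ideal.mul_mem_left _ _ (sub_mem (hK h10) (hK h3))
    · have : (X 1 * (X 1 * X 1) : MvPolynomial (Fin 3) k) =
          X 1 * (X 1 * X 1 - C a * (X 0 * X 0)) + C a * (X 0 * (X 1 * X 0)) := by ring
      simp only [Fin.mk_one]
      rw [this]
      exact add_mem (hK h3) (Ideal.mul_mem_left _ _ (hK h10))
    · have : (X 2 * (X 2 * X 2) : MvPolynomial (Fin 3) k) =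
          X 2 * (X 2 * X 2 - C c * (X 0 * X 0)) + C c * (X 0 * (X 2 * X 0)) := by ring
      simp only [Fin.reduceFinMk]
      rw [this]
      exact add_mem (hK h4) (Ideal.mul_mem_left _ _ (hK h20))
  rw [pow_succ', pow_two, idealOfVars, Ideal.span_mul_span', Ideal.span_mul_span', Ideal.span_le]
  rintro _ ⟨_, ⟨i, rfl⟩, _, ⟨_, ⟨j, rfl⟩, _, ⟨l, rfl⟩, rfl⟩, rfl⟩
  change X i * (X j * X l) ∈ idealOfVars (Fin 3) k * quadIdeal a c
  by_cases hjl : j = l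
  · by_cases hij : i = j
    · rw [← hjl, ← hij]; exact hcube i
    · rw [mul_left_comm]; exact hjl ▸ hK (X_mul_X_mem a c hij)
  · exact hK (X_mul_X_mem a c hjl)

theorem idealOfVars_pow_five_le (ha : a ≠ 0) :
    idealOfVars (Fin 3) k ^ 5 ≤ quadIdeal a c * quadIdeal a c := by
  have h := idealOfVars_pow_three_le (c := c) ha
  calc idealOfVars (Fin 3) k ^ 5 = idealOfVars (Fin 3) k ^ 2 * idealOfVars (Fin 3) k ^ 3 := by
        rw [← pow_add]
    _ ≤ idealOfVars (Fin 3) k ^ 2 * (idealOfVars (Fin 3) k * quadIdeal a c) :=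
        Ideal.mul_mono_right h
    _ = idealOfVars (Fin 3) k ^ 3 * quadIdeal a c := by rw [← mul_assoc, ← pow_succ]
    _ ≤ quadIdeal a c * quadIdeal a c := Ideal.mul_mono_left (h.trans Ideal.mul_le_right)

theorem quadIdeal_le_sq : quadIdeal a c ≤ idealOfVars (Fin 3) k ^ 2 := by
  rw [quadIdeal, Ideal.span_le, pow_two]
  have h (i j : Fin 3) : (X i * X j : MvPolynomial (Fin 3) k) ∈
      idealOfVars (Fin 3) k * idealOfVars (Fin 3) k :=
    Ideal.mul_mem_mul (X_mem_idealOfVars i) (X_mem_idealOfVars j)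
  rintro _ ⟨i, rfl⟩
  fin_cases i
  exacts [h 1 2, h 0 2, h 0 1, sub_mem (Ideal.mul_mem_left _ _ (h 0 0)) (h 1 1),
    sub_mem (Ideal.mul_mem_left _ _ (h 0 0)) (h 2 2)]

theorem quadFun_mul_eq_zero {p : MvPolynomial (Fin 3) k} (hp : p ∈ quadIdeal a c)
    (r : MvPolynomial (Fin 3) k) : quadFun a c (p * r) = 0 := by
  induction hp using Submodule.span_induction generalizing r with
  | mem p hp =>
    obtain ⟨i, rfl⟩ := hp
    fin_cases i <;>
    simp [quadForm, quadFun, mul_assoc, sub_mul, coeffFun_X_zero_mul, coeffFun_X_one_mul,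
      coeffFun_X_two_mul, coeffFun_zero_X_zero_mul, coeffFun_zero_X_one_mul,
      coeffFun_zero_X_two_mul, coeffFun_C_mul]
  | zero => simp
  | add p q _ _ hp hq => rw [add_mul, map_add, hp, hq, add_zero]
  | smul s p _ hp => rw [smul_eq_mul, mul_assoc, mul_left_comm, hp]

/-- The classes of `1, X₀, X₁, X₂, X₀²` span the quotient by `quadIdeal a c`. -/
theorem exists_normal_form (ha : a ≠ 0) (p : MvPolynomial (Fin 3) k) :
    ∃ (α : k) (β : Fin 3 → k) (γ : k),
      p - (C α + ∑ i, C (β i) * X i + C γ * (X 0 * X 0)) ∈ quadIdeal a c := by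
  induction p using MvPolynomial.induction_on with
  | C r => exact ⟨r, 0, 0, by simp⟩
  | add p q hp hq =>
    obtain ⟨α, β, γ, h⟩ := hp
    obtain ⟨α', β', γ', h'⟩ := hq
    refine ⟨α + α', β + β', γ + γ', ?_⟩
    convert add_mem h h' using 1
    simp only [C_add, Pi.add_apply, add_mul, Finset.sum_add_distrib]
    ring
  | mul_X p j hp =>
    obtain ⟨α, β, γ, h⟩ := hp
    refine ⟨0, Pi.single j α, β j * (![1, a, c] : Fin 3 → k) j, ?_⟩
    have h1 := Ideal.mul_mem_right (X j) _ h
    have h2 : (∑ i, C (β i) * (X i * X j - if i = j then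
        C ((![1, a, c] : Fin 3 → k) i) * (X 0 * X 0) else 0) : MvPolynomial (Fin 3) k) ∈
        quadIdeal a c :=
      sum_mem fun i _ => Ideal.mul_mem_left _ _ (X_mul_X_sub_mem a c i j)
    have h3 : (X 0 * (X 0 * X j) : MvPolynomial (Fin 3) k) ∈ quadIdeal a c := by
      refine ((idealOfVars_pow_three_le ha).trans Ideal.mul_le_right) ?_
      rw [pow_succ', pow_two]
      exact Ideal.mul_mem_mul (X_mem_idealOfVars _)
        (Ideal.mul_mem_mul (X_mem_idealOfVars _) (X_mem_idealOfVars _))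
    convert add_mem (add_mem h1 h2) (Ideal.mul_mem_left _ (C γ) h3) using 1
    simp only [mul_sub, Finset.sum_sub_distrib, mul_ite, mul_zero, Finset.sum_ite_eq',
      Finset.mem_univ, if_true, Pi.single_apply, apply_ite C, C_0, ite_mul, zero_mul, C_mul,
      sub_mul, add_mul, Finset.sum_mul, mul_assoc]
    ring

/-- The ideal `quadIdeal a c` is the annihilator of the functional `quadFun a c`. -/
theorem mem_quadIdeal_iff (ha : a ≠ 0) (hc : c ≠ 0) (p : MvPolynomial (Fin 3) k) :
    p ∈ quadIdeal a c ↔ ∀ r, quadFun a c (p * r) = 0 := by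
  refine ⟨fun hp r => quadFun_mul_eq_zero hp r, fun h => ?_⟩
  obtain ⟨α, β, γ, hp⟩ := exists_normal_form (c := c) ha p
  have key (r : MvPolynomial (Fin 3) k) : quadFun a c (C α * r + C (β 0) * (X 0 * r) +
      C (β 1) * (X 1 * r) + C (β 2) * (X 2 * r) + C γ * (X 0 * (X 0 * r))) = 0 := by
    have h1 := quadFun_mul_eq_zero hp r
    rw [sub_mul, map_sub, h, zero_sub, neg_eq_zero] at h1
    rw [← h1, Fin.sum_univ_three]
    congr 1
    ring
  -- Testing against `X₀², X₀, X₁, X₂, 1` makes the coefficients vanish one by one.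
  have hα := key (X 0 * (X 0 * C 1))
  have hβ0 := key (X 0 * C 1)
  have hβ1 := key (X 1 * C 1)
  have hβ2 := key (X 2 * C 1)
  have hγ := key (C 1)
  simp only [quadFun, map_add, LinearMap.add_apply, LinearMap.smul_apply, coeffFun_C_mul,
    coeffFun_X_zero_mul, coeffFun_X_one_mul, coeffFun_X_two_mul, coeffFun_zero_X_zero_mul,
    coeffFun_zero_X_one_mul, coeffFun_zero_X_two_mul, coeffFun_C] at hα hβ0 hβ1 hβ2 hγ
  simp [ha, hc] at hα hβ0 hβ1 hβ2 hγ
  simpa [Fin.sum_univ_three, hα, hβ0, hβ1, hβ2, hγ] using hp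

end QuadIdeal

/-! ### Direct summands of second syzygies -/

section Syzygy

/-- By Nakayama, an endomorphism of a finitely generated module over a Noetherian local ring which
is the identity modulo the maximal ideal is bijective. -/
theorem bijective_of_sub_id_mem {R T : Type*} [CommRing R] [IsLocalRing R] [IsNoetherianRing R]
    [AddCommGroup T] [Module R T] [Module.Finite R T] (f : T →ₗ[R] T)
    (hf : ∀ x, f x - x ∈ IsLocalRing.maximalIdeal R • (⊤ : Submodule R T)) :
    Function.Bijective f := by
  have hsurj : Function.Surjective f := by
    rw [← LinearMap.range_eq_top]
    refine top_le_iff.1 (Submodule.le_of_le_smul_of_le_jacobson_bot (Module.Finite.fg_top)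
      (IsLocalRing.maximalIdeal_le_jacobson ⊥) fun x _ => ?_)
    rw [← sub_sub_cancel (f x) x]
    exact sub_mem (Submodule.mem_sup_left ⟨x, rfl⟩) (Submodule.mem_sup_right (hf x))
  exact ⟨IsNoetherian.injective_of_surjective_endomorphism f hsurj, hsurj⟩

/-- A criterion for a finitely generated module `T` over a Noetherian local ring to be a direct
summand of every second syzygy module of `ω`: there are an exact sequence
`0 → T → E → G → ω → 0` with `G` projective, and a factorization of `T → E` through a map
`T → H` into a projective module whose image lies in `𝔪 H`. -/
theorem IsSecondSyzygy.exists_retraction {R : Type u} [CommRing R] [IsLocalRing R]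
    [IsNoetherianRing R] {T E G H ω Z : Type u}
    [AddCommGroup T] [Module R T] [AddCommGroup E] [Module R E] [AddCommGroup G] [Module R G]
    [AddCommGroup H] [Module R H] [AddCommGroup ω] [Module R ω] [AddCommGroup Z] [Module R Z]
    [Module.Finite R T] [Module.Projective R G] [Module.Projective R H]
    (i : T →ₗ[R] E) (d : E →ₗ[R] G) (e : G →ₗ[R] ω)
    (hi : Function.Injective i) (hid : Function.Exact i d) (hde : Function.Exact d e)
    (he : Function.Surjective e)
    (t : T →ₗ[R] H) (h : H →ₗ[R] E) (hti : h.comp t = i)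
    (htm : ∀ x, t x ∈ IsLocalRing.maximalIdeal R • (⊤ : Submodule R H))
    (hZ : IsSecondSyzygy R Z ω) :
    ∃ (f : T →ₗ[R] Z) (g : Z →ₗ[R] T), Function.Bijective (g.comp f) := by
  obtain ⟨F₂, F₁, _, _, _, _, j, δ, ε, _, _, hj, hjδ, hδε, hε⟩ := hZ
  -- Comparison maps from the given resolution to the exact sequence `T → E → G → ω`.
  obtain ⟨a₁, ha₁⟩ := Module.projective_lifting_property e ε he
  have hδ0 (x : F₂) : ε (δ x) = 0 := hδε.apply_apply_eq_zero x
  have hd0 (x : E) : e (d x) = 0 := hde.apply_apply_eq_zero x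
  have hda (x : F₂) : a₁ (δ x) ∈ LinearMap.range d :=
    (hde _).1 (by rw [← LinearMap.comp_apply, ha₁, hδ0])
  obtain ⟨a₂, ha₂⟩ := Module.projective_lifting_property d.rangeRestrict
    ((a₁.comp δ).codRestrict _ hda) d.surjective_rangeRestrict
  replace ha₂ (x : F₂) : d (a₂ x) = a₁ (δ x) := congrArg Subtype.val (LinearMap.congr_fun ha₂ x)
  have haZ (z : Z) : a₂ (j z) ∈ LinearMap.range i :=
    (hid _).1 (by rw [ha₂, hjδ.apply_apply_eq_zero, map_zero])
  let i' : T ≃ₗ[R] LinearMap.range i := LinearEquiv.ofInjective i hi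
  let g : Z →ₗ[R] T := i'.symm.toLinearMap.comp ((a₂.comp j).codRestrict _ haZ)
  have hg (z : Z) : i (g z) = a₂ (j z) :=
    congrArg Subtype.val (i'.apply_symm_apply ⟨a₂ (j z), haZ z⟩)
  -- Comparison maps in the other direction.
  obtain ⟨b₁, hb₁⟩ := Module.projective_lifting_property ε e hε
  have hbd (x : H) : b₁ (d (h x)) ∈ LinearMap.range δ :=
    (hδε _).1 (by rw [← LinearMap.comp_apply, hb₁, hd0])
  obtain ⟨b₂, hb₂⟩ := Module.projective_lifting_property δ.rangeRestrict
    ((b₁.comp (d.comp h)).codRestrict _ hbd) δ.surjective_rangeRestrict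
  replace hb₂ (x : H) : δ (b₂ x) = b₁ (d (h x)) :=
    congrArg Subtype.val (LinearMap.congr_fun hb₂ x)
  have hht (x : T) : h (t x) = i x := LinearMap.congr_fun hti x
  have hbT (x : T) : b₂ (t x) ∈ LinearMap.range j :=
    (hjδ _).1 (by rw [hb₂, hht, hid.apply_apply_eq_zero, map_zero])
  let j' : Z ≃ₗ[R] LinearMap.range j := LinearEquiv.ofInjective j hj
  let f : T →ₗ[R] Z := j'.symm.toLinearMap.comp ((b₂.comp t).codRestrict _ hbT)
  have hf (x : T) : j (f x) = b₂ (t x) :=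
    congrArg Subtype.val (j'.apply_symm_apply ⟨b₂ (t x), hbT x⟩)
  -- The composite `G → F₁ → G` differs from the identity by a map into the range of `d`.
  have hc (x : G) : a₁ (b₁ x) - x ∈ LinearMap.range d :=
    (hde _).1 (by
      rw [map_sub, ← LinearMap.comp_apply, ha₁, ← LinearMap.comp_apply, hb₁, sub_self])
  obtain ⟨c, hc'⟩ := Module.projective_lifting_property d.rangeRestrict
    ((a₁.comp b₁ - LinearMap.id).codRestrict _ hc) d.surjective_rangeRestrict
  replace hc' (x : G) : d (c x) = a₁ (b₁ x) - x :=
    congrArg Subtype.val (LinearMap.congr_fun hc' x)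
  -- On `H` the composite of the comparison maps is, up to the homotopy `c`, `h` plus a map `r`
  -- into `T`.
  have hr (x : H) : a₂ (b₂ x) - h x - c (d (h x)) ∈ LinearMap.range i :=
    (hid _).1 (by rw [map_sub, map_sub, ha₂, hb₂, hc']; abel)
  let r : H →ₗ[R] T := i'.symm.toLinearMap.comp
    ((a₂.comp b₂ - h - c.comp (d.comp h)).codRestrict _ hr)
  have hr' (x : H) : i (r x) = a₂ (b₂ x) - h x - c (d (h x)) :=
    congrArg Subtype.val (i'.apply_symm_apply ⟨_, hr x⟩)
  refine ⟨f, g, bijective_of_sub_id_mem _ fun x => ?_⟩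
  -- The defect `g (f x) - x` factors through `t`, hence lies in `𝔪 T`.
  have hx : g.comp f x - x = r (t x) := by
    apply hi
    rw [map_sub, LinearMap.comp_apply, hg, hf, hr', hht, hid.apply_apply_eq_zero, map_zero,
      sub_zero]
  rw [hx]
  have := Submodule.mem_map_of_mem (f := r) (htm x)
  rw [Submodule.map_smul''] at this
  exact Submodule.smul_mono le_rfl le_top this

/-- A retract of `Z` is a direct summand. -/
theorem hasDirectSummandIso_of_bijective_comp {P : Type u} [CommRing P] (J : Ideal P)
    (Z T U : Type u) [AddCommGroup Z] [Module (P ⧸ J) Z] [AddCommGroup T] [Module (P ⧸ J) T]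
    [AddCommGroup U] [Module P U] (f : T →ₗ[P ⧸ J] Z) (g : Z →ₗ[P ⧸ J] T) (hgf : Function.Bijective (g.comp f))
    (u : U →ₛₗ[Ideal.Quotient.mk J] T) (hu : Function.Bijective u) :
    HasDirectSummandIso J Z U := by
  have hf : Function.Injective f := by
    refine Function.Injective.of_comp (f := g) ?_
    exact hgf.1
  refine ⟨LinearMap.range f, LinearMap.ker g, ⟨?_, ?_⟩,
    (f.rangeRestrict : T →ₗ[P ⧸ J] LinearMap.range f).comp u, ?_⟩
  · rw [Submodule.disjoint_def]
    rintro _ ⟨x, rfl⟩ hx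
    rw [hgf.1 (a₁ := x) (a₂ := 0) (by simpa using hx), map_zero]
  · rw [codisjoint_iff, eq_top_iff]
    intro z _
    obtain ⟨x, hx⟩ := hgf.2 (g z)
    rw [← add_sub_cancel (f x) z]
    refine Submodule.add_mem_sup ⟨x, rfl⟩ ?_
    rw [LinearMap.mem_ker, map_sub, sub_eq_zero]
    exact hx.symm
  · rw [LinearMap.coe_comp]
    refine Function.Bijective.comp ⟨?_, f.surjective_rangeRestrict⟩ hu
    intro x y hxy
    exact hf (congrArg Subtype.val hxy)

end Syzygy

section Construction

/-- The criterion `IsSecondSyzygy.exists_retraction` for the exact sequence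
`0 → G ⧸ G₀ → N ⧸ (A G + w G₀) → G ⧸ J G → ω → 0`, where `G = P ^ κ`, the first map is
multiplication by `w`, and `N ⧸ J G` is the kernel of `G ⧸ J G → ω`. The maps `X j` and the vectors `S j` describe
the factorization of multiplication by `w` through `(P ⧸ J) ^ n`. -/
theorem IsSecondSyzygy.hasDirectSummandIso {P : Type u} [CommRing P] {A B J : Ideal P}
    [IsLocalRing (P ⧸ J)] [IsNoetherianRing (P ⧸ J)]
    {w : P} (hJ : ∀ x, x ∈ J ↔ ∃ p, x - w * p ∈ A) (hwB : ∀ x, w * x ∈ A → x ∈ B)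
    {κ : Type} [Finite κ] (N G₀ : Submodule P (κ → P)) (hN : N ≤ G₀)
    (hBG : ∀ u : κ → P, (∀ i, u i ∈ B) → u ∈ G₀) (hJN : ∀ u : κ → P, (∀ i, u i ∈ J) → u ∈ N)
    {ω : Type u} [AddCommGroup ω] [Module (P ⧸ J) ω] (e : (κ → P ⧸ J) →ₗ[P ⧸ J] ω)
    (he : Function.Surjective e)
    (heN : ∀ u : κ → P, e (fun i => Ideal.Quotient.mk J (u i)) = 0 ↔ u ∈ N)
    {n : ℕ} (X : Fin n → (κ → P) →ₗ[P] P) (hX₀ : ∀ j, ∀ u ∈ G₀, X j u ∈ J)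
    (hXm : ∀ j u, Ideal.Quotient.mk J (X j u) ∈ IsLocalRing.maximalIdeal (P ⧸ J))
    (S : Fin n → κ → P) (hS : ∀ j, S j ∈ N)
    (hXS : ∀ u, ∃ v ∈ G₀, ∀ i, ∑ j, X j u * S j i - w * u i - w * v i ∈ A)
    {U : Type u} [AddCommGroup U] [Module P U] (χ : (κ → P) →ₗ[P] U) (hχ : Function.Surjective χ)
    (hχ₀ : LinearMap.ker χ = G₀)
    {Z : Type u} [AddCommGroup Z] [Module (P ⧸ J) Z] (hZ : IsSecondSyzygy (P ⧸ J) Z ω) :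
    HasDirectSummandIso J Z U := by
  have : Fintype κ := Fintype.ofFinite κ
  have hwJ (p : P) : w * p ∈ J := (hJ _).2 ⟨p, by simp⟩
  have hAJ : A ≤ J := fun a ha => (hJ _).2 ⟨0, by simpa using ha⟩
  -- `T = G / G₀`, a module over `P ⧸ J`.
  have hT : Module.IsTorsionBySet P ((κ → P) ⧸ G₀) (J : Set P) := by
    rintro x ⟨r, hr⟩
    obtain ⟨x, rfl⟩ := G₀.mkQ_surjective x
    exact (Submodule.Quotient.mk_eq_zero _).2 (hN (hJN _ fun i => J.mul_mem_right _ hr))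
  let _ : Module (P ⧸ J) ((κ → P) ⧸ G₀) := hT.module
  have : IsScalarTower P (P ⧸ J) ((κ → P) ⧸ G₀) := hT.isScalarTower
  -- `E = N / (A G + w G₀)`.
  let W : Submodule P (κ → P) :=
    { carrier := {u | ∃ v ∈ G₀, ∀ i, u i - w * v i ∈ A}
      add_mem' := by
        rintro u u' ⟨v, hv, h⟩ ⟨v', hv', h'⟩
        refine ⟨v + v', add_mem hv hv', fun i => ?_⟩
        convert add_mem (h i) (h' i) using 1
        simp only [Pi.add_apply]; ring
      zero_mem' := ⟨0, zero_mem _, by simp⟩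
      smul_mem' := by
        rintro p u ⟨v, hv, h⟩
        refine ⟨p • v, G₀.smul_mem p hv, fun i => ?_⟩
        convert A.mul_mem_left p (h i) using 1
        simp only [Pi.smul_apply, smul_eq_mul]; ring }
  let E := N ⧸ W.comap N.subtype
  have hE : Module.IsTorsionBySet P E (J : Set P) := by
    rintro x ⟨r, hr⟩
    obtain ⟨⟨x, hx⟩, rfl⟩ := (W.comap N.subtype).mkQ_surjective x
    refine (Submodule.Quotient.mk_eq_zero _).2 ?_
    obtain ⟨p, hp⟩ := (hJ r).1 hr
    refine ⟨p • x, hN (N.smul_mem p hx), fun i => ?_⟩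
    convert A.mul_mem_right (x i) hp using 1
    simp [sub_mul, mul_assoc]
  let _ : Module (P ⧸ J) E := hE.module
  have : IsScalarTower P (P ⧸ J) E := hE.isScalarTower
  have hsurj : Function.Surjective (algebraMap P (P ⧸ J)) := Ideal.Quotient.mk_surjective
  -- `i : T → E` is multiplication by `w`.
  let i₀ : (κ → P) →ₗ[P] N := (LinearMap.lsmul P (κ → P) w).codRestrict N
    fun u => hJN _ fun i => hwJ _
  let i : ((κ → P) ⧸ G₀) →ₗ[P] E := G₀.liftQ ((W.comap N.subtype).mkQ.comp i₀) fun u hu =>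
    (Submodule.Quotient.mk_eq_zero _).2 ⟨u, hu, by simp [i₀]⟩
  have hi : Function.Injective i := by
    rw [← LinearMap.ker_eq_bot]
    refine Submodule.ker_liftQ_eq_bot _ _ _ fun u hu => ?_
    obtain ⟨v, hv, h⟩ := (Submodule.Quotient.mk_eq_zero _).1 hu
    have h1 : u - v ∈ G₀ := hBG _ fun i => hwB _ (by simpa [i₀, mul_sub] using h i)
    simpa using add_mem h1 hv
  -- `d : E → G ⧸ J G` is induced by the inclusion of `N`.
  let d₀ : (κ → P) →ₗ[P] (κ → P ⧸ J) :=
    LinearMap.pi fun i => (Algebra.linearMap P (P ⧸ J)).comp (LinearMap.proj i)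
  have hd₀ (u : κ → P) : d₀ u = 0 ↔ ∀ i, u i ∈ J := by
    simp only [funext_iff, d₀]
    exact forall_congr' fun i => Ideal.Quotient.eq_zero_iff_mem
  let d : E →ₗ[P] (κ → P ⧸ J) := (W.comap N.subtype).liftQ (d₀.comp N.subtype) <| by
    rintro ⟨u, hu⟩ ⟨v, hv, h⟩
    rw [LinearMap.mem_ker, LinearMap.comp_apply, hd₀]
    intro i
    have := add_mem (hAJ (h i)) (hwJ (v i))
    rwa [sub_add_cancel] at this
  have hid : Function.Exact i d := by
    intro x
    constructor
    · obtain ⟨⟨u, hu⟩, rfl⟩ := (W.comap N.subtype).mkQ_surjective x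
      intro h
      have h' : ∀ i, u i ∈ J := (hd₀ u).1 h
      choose v hv using fun i => (hJ _).1 (h' i)
      refine ⟨Submodule.Quotient.mk v, ((Submodule.Quotient.eq _).2 ?_)⟩
      refine ⟨0, zero_mem _, fun i => ?_⟩
      simpa [i₀] using neg_mem (hv i)
    · rintro ⟨x, rfl⟩
      obtain ⟨u, rfl⟩ := G₀.mkQ_surjective x
      exact (hd₀ _).2 fun i => hwJ (u i)
  have hde : Function.Exact (d.extendScalarsOfSurjective hsurj) e := by
    intro x
    choose u hu using fun i => Ideal.Quotient.mk_surjective (I := J) (x i)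
    obtain rfl : (fun i => Ideal.Quotient.mk J (u i)) = x := funext hu
    rw [heN]
    constructor
    · intro h
      exact ⟨Submodule.Quotient.mk ⟨u, h⟩, rfl⟩
    · rintro ⟨y, hy⟩
      obtain ⟨⟨v, hv⟩, rfl⟩ := (W.comap N.subtype).mkQ_surjective y
      rw [← heN] at hv ⊢
      rw [← hv, ← hy]
      rfl
  -- The factorization `T → (P ⧸ J) ^ n → E` of `i`.
  let t₀ : (κ → P) →ₗ[P] (Fin n → P ⧸ J) :=
    LinearMap.pi fun j => (Algebra.linearMap P (P ⧸ J)).comp (X j)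
  let t : ((κ → P) ⧸ G₀) →ₗ[P] (Fin n → P ⧸ J) := G₀.liftQ t₀ fun u hu => by
    rw [LinearMap.mem_ker]
    exact funext fun j => Ideal.Quotient.eq_zero_iff_mem.2 (hX₀ j u hu)
  let h : (Fin n → P ⧸ J) →ₗ[P ⧸ J] E :=
    Fintype.linearCombination (P ⧸ J) fun j => (W.comap N.subtype).mkQ ⟨S j, hS j⟩
  have hti : h.comp (t.extendScalarsOfSurjective hsurj) = i.extendScalarsOfSurjective hsurj := by
    refine LinearMap.ext fun x => ?_
    obtain ⟨u, rfl⟩ := G₀.mkQ_surjective x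
    have h1 : h (t (G₀.mkQ u)) = (W.comap N.subtype).mkQ (∑ j, X j u • ⟨S j, hS j⟩) := by
      rw [Fintype.linearCombination_apply, map_sum]
      refine Finset.sum_congr rfl fun j _ => ?_
      rw [map_smul]
      exact algebraMap_smul (P ⧸ J) (X j u) _
    change h (t (G₀.mkQ u)) = _
    rw [h1]
    obtain ⟨v, hv, hv'⟩ := hXS u
    refine (Submodule.Quotient.eq _).2 ⟨v, hv, fun l => ?_⟩
    simpa [i₀] using hv' l
  have htm (x) : t.extendScalarsOfSurjective hsurj x ∈
      IsLocalRing.maximalIdeal (P ⧸ J) • (⊤ : Submodule (P ⧸ J) (Fin n → P ⧸ J)) := by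
    obtain ⟨u, rfl⟩ := G₀.mkQ_surjective x
    change t₀ u ∈ _
    rw [pi_eq_sum_univ (t₀ u)]
    exact sum_mem fun j _ => Submodule.smul_mem_smul (hXm j u) trivial
  have hTfin : Module.Finite (P ⧸ J) ((κ → P) ⧸ G₀) :=
    Module.Finite.of_restrictScalars_finite P _ _
  obtain ⟨f, g, hgf⟩ := hZ.exists_retraction (i.extendScalarsOfSurjective hsurj)
    (d.extendScalarsOfSurjective hsurj) e hi hid hde he (t.extendScalarsOfSurjective hsurj) h
    hti htm
  let v : U ≃ₗ[P] ((κ → P) ⧸ G₀) :=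
    (χ.quotKerEquivOfSurjective hχ).symm.trans (Submodule.quotEquivOfEq _ _ hχ₀)
  refine hasDirectSummandIso_of_bijective_comp J Z _ U f g hgf
    { toFun := v, map_add' := map_add v, map_smul' := fun p x => ?_ } v.bijective
  exact map_smul v p x

end Construction

/-! ### The canonical module of a residual quotient -/

section Canonical

/-- If `A` is the annihilator of a dualizing functional `φ` and `J = A : B`, then the canonical
module of `P ⧸ J` is `B ⧸ A`, so generators of `B` present it. A functional on `ω` which does not vanish on
the socle gives an embedding `ω → B ⧸ A`, and injectivity of `ω` gives an embedding the other way;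
both modules have finite length. -/
theorem IsCanonicalModule.exists_presentation {k : Type u} [Field k] {P : Type u} [CommRing P]
    [Algebra k P] {A B J : Ideal P} (φ : P →ₗ[k] k) (hφ : ∀ x, x ∈ A ↔ ∀ p, φ (x * p) = 0)
    (hφ' : ∀ l : P →ₗ[k] k, (∀ x ∈ A, l x = 0) → ∃ x, ∀ p, l p = φ (x * p))
    (hAB : A ≤ B) (hJ : ∀ x, x ∈ J ↔ ∀ b ∈ B, x * b ∈ A)
    [IsLocalRing (P ⧸ J)] [IsArtinianRing (P ⧸ J)]
    (hres : ∀ r : P ⧸ J, ∃ c : k, r - algebraMap k (P ⧸ J) c ∈ IsLocalRing.maximalIdeal (P ⧸ J))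
    {κ : Type} [Fintype κ] (gen : κ → P) (hgen : Ideal.span (Set.range gen) = B)
    {ω : Type u} [AddCommGroup ω] [Module (P ⧸ J) ω] (hω : IsCanonicalModule (P ⧸ J) ω) :
    ∃ e : (κ → P ⧸ J) →ₗ[P ⧸ J] ω, Function.Surjective e ∧
      ∀ u : κ → P, e (fun i => Ideal.Quotient.mk J (u i)) = 0 ↔ ∑ i, u i * gen i ∈ A := by
  obtain ⟨hinj, ι, hι, hess⟩ := hω
  have hAJ : A ≤ J := fun a ha => (hJ _).2 fun b _ => A.mul_mem_right b ha
  -- `B = A : J`, by duality.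
  have hdouble (x : P) (hx : ∀ y ∈ J, φ (x * y) = 0) : x ∈ B := by
    by_contra hxB
    obtain ⟨l, hl, hlB⟩ := Submodule.exists_le_ker_of_notMem (p := B.restrictScalars k) hxB
    obtain ⟨y, hy⟩ := hφ' l fun a ha => hlB (hAB ha)
    refine hl ?_
    rw [hy, mul_comm]
    refine hx y ((hJ y).2 fun b hb => (hφ _).2 fun p => ?_)
    rw [mul_assoc, ← hy]
    exact hlB (B.mul_mem_right p hb)
  let M := B ⧸ Submodule.comap B.subtype A
  have hM : Module.IsTorsionBySet P M (J : Set P) := by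
    rintro x ⟨r, hr⟩
    obtain ⟨⟨x, hx⟩, rfl⟩ := (Submodule.comap B.subtype A).mkQ_surjective x
    exact (Submodule.Quotient.mk_eq_zero _).2 ((hJ r).1 hr x hx)
  let _ : Module (P ⧸ J) M := hM.module
  have : IsScalarTower P (P ⧸ J) M := hM.isScalarTower
  have hMfin : Module.Finite (P ⧸ J) M := by
    have : Module.Finite P B :=
      Module.Finite.iff_fg.2 (hgen ▸ Submodule.fg_span (Set.finite_range gen))
    exact Module.Finite.of_restrictScalars_finite P _ _
  have hmk (x : B) : (Submodule.Quotient.mk x : M) = 0 ↔ (x : P) ∈ A :=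
    Submodule.Quotient.mk_eq_zero _
  -- An embedding of `ω` into `B / A`.
  let _ : Module k ω := Module.compHom ω (algebraMap k (P ⧸ J))
  have : IsScalarTower k (P ⧸ J) ω := IsScalarTower.of_algebraMap_smul fun _ _ => rfl
  obtain ⟨l, hl⟩ : ∃ l : ω →ₗ[k] k, l (ι 1) ≠ 0 := by
    by_contra! h
    have := (Module.forall_dual_apply_eq_zero_iff k (ι 1)).1 h
    exact one_ne_zero (hι (this.trans (map_zero ι).symm))
  have hex (y : ω) : ∃ x : B, ∀ p, l (Ideal.Quotient.mk J p • y) = φ (x * p) := by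
    let ly : P →ₗ[k] k := l.comp
      (((LinearMap.toSpanSingleton (P ⧸ J) ω y).restrictScalars k).comp
        (Ideal.Quotient.mkₐ k J).toLinearMap)
    have hly (p : P) : ly p = l (Ideal.Quotient.mk J p • y) := rfl
    have hlJ (p : P) (hp : p ∈ J) : ly p = 0 := by
      rw [hly, Ideal.Quotient.eq_zero_iff_mem.2 hp, zero_smul, map_zero]
    obtain ⟨x, hx⟩ := hφ' ly fun a ha => hlJ a (hAJ ha)
    exact ⟨⟨x, hdouble x fun p hp => by rw [← hx, hlJ p hp]⟩, hx⟩
  choose f₀ hf₀ using hex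
  have hf₀' (y : ω) (x : B) (h : ∀ p, l (Ideal.Quotient.mk J p • y) = φ (x * p)) :
      (Submodule.Quotient.mk (f₀ y) : M) = Submodule.Quotient.mk x := by
    rw [← sub_eq_zero, ← Submodule.Quotient.mk_sub, hmk, hφ]
    intro p
    rw [Submodule.coe_sub, sub_mul, map_sub, ← h, ← hf₀, sub_self]
  let f : ω →ₗ[P ⧸ J] M :=
    { toFun y := Submodule.Quotient.mk (f₀ y)
      map_add' y y' := by
        rw [← Submodule.Quotient.mk_add]
        refine hf₀' _ _ fun p => ?_
        rw [smul_add, map_add, hf₀, hf₀, Submodule.coe_add, add_mul, map_add]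
      map_smul' r y := by
        obtain ⟨q, rfl⟩ := Ideal.Quotient.mk_surjective r
        refine hf₀' _ (q • f₀ y) fun p => ?_
        rw [smul_smul, ← map_mul, hf₀, SetLike.val_smul, smul_eq_mul]
        congr 1; ring }
  have hf : Function.Injective f := by
    rw [← LinearMap.ker_eq_bot]
    by_contra hne
    have h1 := hess _ hne
    rw [Submodule.ne_bot_iff] at h1
    obtain ⟨_, ⟨hy, c, rfl⟩, hy0⟩ := h1
    have hc : c ≠ 0 := by rintro rfl; exact hy0 (map_zero ι)
    obtain ⟨s, hs⟩ := IsLocalRing.residue_surjective (R := P ⧸ J) c⁻¹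
    obtain ⟨p, rfl⟩ := Ideal.Quotient.mk_surjective s
    have h2 : ι 1 = Ideal.Quotient.mk J p • ι c := by
      rw [← map_smul, ← inv_mul_cancel₀ hc, ← hs]
      rfl
    refine hl ?_
    rw [h2, hf₀]
    exact (hφ _).1 ((hmk _).1 hy) p
  -- The socle of `B / A` is one-dimensional.
  have hsoc (z z' : M) (hz : z ≠ 0) (hzm : ∀ r ∈ IsLocalRing.maximalIdeal (P ⧸ J), r • z = 0)
      (hzm' : ∀ r ∈ IsLocalRing.maximalIdeal (P ⧸ J), r • z' = 0) : ∃ r : P ⧸ J, z' = r • z := by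
    have key (x : B) (hx : ∀ r ∈ IsLocalRing.maximalIdeal (P ⧸ J),
        r • (Submodule.Quotient.mk x : M) = 0) (p : P) (c : k)
        (hpc : Ideal.Quotient.mk J p - algebraMap k (P ⧸ J) c ∈ IsLocalRing.maximalIdeal (P ⧸ J)) :
        φ (x * p) = c * φ x := by
      have h1 : (p - algebraMap k P c) * x ∈ A := by
        have h2 := hx _ hpc
        rw [show algebraMap k (P ⧸ J) c = Ideal.Quotient.mk J (algebraMap k P c) from rfl,
          ← map_sub] at h2
        exact (hmk ((p - algebraMap k P c) • x)).1 h2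
      have h3 := (hφ _).1 h1 1
      rw [mul_one, sub_mul, map_sub, sub_eq_zero, ← Algebra.smul_def, map_smul, mul_comm] at h3
      exact h3
    obtain ⟨x, rfl⟩ := (Submodule.comap B.subtype A).mkQ_surjective z
    obtain ⟨x', rfl⟩ := (Submodule.comap B.subtype A).mkQ_surjective z'
    have hx0 : φ x ≠ 0 := by
      intro h0
      refine hz ((hmk x).2 ((hφ _).2 fun p => ?_))
      obtain ⟨c, hc⟩ := hres (Ideal.Quotient.mk J p)
      rw [key x hzm p c hc, h0, mul_zero]
    refine ⟨Ideal.Quotient.mk J (algebraMap k P (φ x' / φ x)), ?_⟩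
    refine (Submodule.Quotient.eq _).2 ((hφ _).2 fun p => ?_)
    obtain ⟨c, hc⟩ := hres (Ideal.Quotient.mk J p)
    change φ ((x' - algebraMap k P (φ x' / φ x) * x) * p) = 0
    rw [sub_mul, map_sub, mul_assoc, ← Algebra.smul_def, map_smul, key x hzm p c hc,
      key x' hzm' p c hc, smul_eq_mul]
    field_simp
    ring
  -- An embedding of `B / A` into `ω`.
  have hMnt : Nontrivial M := by
    refine ⟨f (ι 1), 0, fun h => hl ?_⟩
    rw [hf (h.trans (map_zero f).symm), map_zero]
  obtain ⟨z, hz0, hz⟩ := IsArtinianRing.exists_socle_element (P ⧸ J) M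
  let g : IsLocalRing.ResidueField (P ⧸ J) →ₗ[P ⧸ J] M :=
    Submodule.liftQ _ (LinearMap.toSpanSingleton (P ⧸ J) M z) fun r hr => by
      simpa using (hz r).2 hr
  have hg (r : P ⧸ J) : g (IsLocalRing.residue (P ⧸ J) r) = r • z := rfl
  have hginj : Function.Injective g := by
    rw [← LinearMap.ker_eq_bot]
    exact Submodule.ker_liftQ_eq_bot _ _ _ fun r hr => (hz r).1 (by simpa using hr)
  obtain ⟨h, hh⟩ := hinj.out g hginj ι
  have hhinj : Function.Injective h := by
    rw [← LinearMap.ker_eq_bot]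
    by_contra hne
    have : Nontrivial (LinearMap.ker h) := Submodule.nontrivial_iff_ne_bot.2 hne
    obtain ⟨⟨y, hy⟩, hy0, hym⟩ := IsArtinianRing.exists_socle_element (P ⧸ J) (LinearMap.ker h)
    obtain ⟨r, rfl⟩ := hsoc z y hz0 (fun r hr => (hz r).2 hr)
      fun r hr => congrArg Subtype.val ((hym r).2 hr)
    rw [LinearMap.mem_ker, ← hg, hh] at hy
    have : IsLocalRing.residue (P ⧸ J) r = 0 := hι (hy.trans (map_zero ι).symm)
    refine hy0 (Subtype.ext ?_)
    change r • z = 0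
    rw [← hg, this, map_zero]
  have hfsurj : Function.Surjective f := by
    have h1 := IsArtinian.surjective_of_injective_endomorphism (f.comp h) (hf.comp hhinj)
    exact Function.Surjective.of_comp h1
  let f' : ω ≃ₗ[P ⧸ J] M := LinearEquiv.ofBijective f ⟨hf, hfsurj⟩
  let e₀ : (κ → P ⧸ J) →ₗ[P ⧸ J] M := Fintype.linearCombination (P ⧸ J) fun i =>
    Submodule.Quotient.mk ⟨gen i, hgen ▸ Ideal.subset_span ⟨i, rfl⟩⟩
  have he₀ (u : κ → P) : e₀ (fun i => Ideal.Quotient.mk J (u i)) =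
      Submodule.Quotient.mk (∑ i, u i • ⟨gen i, hgen ▸ Ideal.subset_span ⟨i, rfl⟩⟩ : B) := by
    rw [Fintype.linearCombination_apply, ← Submodule.mkQ_apply, map_sum]
    exact Finset.sum_congr rfl fun i _ => rfl
  refine ⟨f'.symm.toLinearMap.comp e₀, f'.symm.surjective.comp fun x => ?_, fun u => ?_⟩
  · obtain ⟨⟨x, hx⟩, rfl⟩ := (Submodule.comap B.subtype A).mkQ_surjective x
    rw [← hgen] at hx
    obtain ⟨u, hu⟩ := (Submodule.mem_span_range_iff_exists_fun P).1 hx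
    refine ⟨fun i => Ideal.Quotient.mk J (u i), ?_⟩
    rw [he₀]
    congr 1
    ext
    simpa using hu
  · change f'.symm (e₀ _) = 0 ↔ _
    rw [LinearEquiv.map_eq_zero_iff, he₀, hmk]
    simp

end Canonical

/-! ### The direct summand for quadrics in normal form -/

section Core

/-- For a retraction `ρ` of `σ`, an element of the extended ideal `I P` differs from the lift of its
image in `Q` by an element of `(ker ρ) I P`. -/
theorem map_sub_mem_ker_mul {Q P : Type*} [CommRing Q] [CommRing P] (ρ : P →+* Q) (σ : Q →+* P)
    (hρσ : ∀ q, ρ (σ q) = q) (I : Ideal Q) {p : P} (hp : p ∈ I.map σ) :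
    p - σ (ρ p) ∈ RingHom.ker ρ * I.map σ := by
  induction hp using Submodule.span_induction with
  | mem p hp =>
    obtain ⟨q, -, rfl⟩ := hp
    simp [hρσ]
  | zero => simp
  | add p q _ _ hp hq =>
    convert add_mem hp hq using 1
    simp only [map_add]; ring
  | smul r p hp' hp =>
    have h1 : r - σ (ρ r) ∈ RingHom.ker ρ := by simp [RingHom.mem_ker, hρσ]
    have h2 : r • p - σ (ρ (r • p)) = (r - σ (ρ r)) * p + σ (ρ r) * (p - σ (ρ p)) := by
      simp only [smul_eq_mul, map_mul]; ring
    rw [h2]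
    exact add_mem (Ideal.mul_mem_mul h1 hp') (Ideal.mul_mem_left _ (σ (ρ r)) hp)

/-- The theorem for the quadrics in normal form. The polynomial ring in three variables is a retract
of `P` with the ideal of the `Y`'s as kernel of the retraction, and the Gorenstein property of `P ⧸ A`
is expressed by the dualizing functional `φ`. -/
theorem hasDirectSummandIso_of_normal_form {k : Type u} [Field k] {P : Type u} [CommRing P]
    [Algebra k P] (ρ : P →ₐ[k] MvPolynomial (Fin 3) k) (σ : MvPolynomial (Fin 3) k →ₐ[k] P)
    (hρσ : ∀ q, ρ (σ q) = q) {a c : k} (ha : a ≠ 0) (hc : c ≠ 0) {s : ℕ} (y : Fin s → P)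
    (hy : Ideal.span (Set.range y) = RingHom.ker ρ) {A B B' J : Ideal P}
    (hB' : B' = (quadIdeal a c).map σ) (hB : B = B' ⊔ RingHom.ker ρ)
    (hA : ∀ x ∈ A, ρ x ∈ idealOfVars (Fin 3) k ^ 5)
    (φ : P →ₗ[k] k) (hφ : ∀ x, x ∈ A ↔ ∀ p, φ (x * p) = 0)
    (hφ' : ∀ l : P →ₗ[k] k, (∀ x ∈ A, l x = 0) → ∃ x, ∀ p, l p = φ (x * p))
    (hJ : ∀ x, x ∈ J ↔ ∀ b ∈ B, x * b ∈ A)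
    [IsLocalRing (P ⧸ J)] [IsArtinianRing (P ⧸ J)]
    (hres : ∀ r : P ⧸ J, ∃ c : k, r - algebraMap k (P ⧸ J) c ∈ IsLocalRing.maximalIdeal (P ⧸ J))
    {ω : Type u} [AddCommGroup ω] [Module (P ⧸ J) ω] (hω : IsCanonicalModule (P ⧸ J) ω)
    {Z : Type u} [AddCommGroup Z] [Module (P ⧸ J) Z] (hZ : IsSecondSyzygy (P ⧸ J) Z ω) :
    HasDirectSummandIso J Z (B' ⧸ (B • ⊤ : Submodule P B')) := by
  have hBmem (x : P) : x ∈ B ↔ ρ x ∈ quadIdeal a c := by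
    constructor
    · intro hx
      have : B ≤ (quadIdeal a c).comap ρ := by
        rw [hB, hB', sup_le_iff, Ideal.map_le_iff_le_comap]
        refine ⟨fun q hq => ?_, fun p hp => ?_⟩
        · rw [Ideal.mem_comap, Ideal.mem_comap, hρσ]; exact hq
        · rw [Ideal.mem_comap, (RingHom.mem_ker (f := ρ)).1 hp]; exact zero_mem _
      exact this hx
    · intro hx
      rw [hB, ← add_sub_cancel (σ (ρ x)) x]
      refine Submodule.add_mem_sup (hB' ▸ Ideal.mem_map_of_mem σ hx) ?_
      rw [RingHom.mem_ker]
      simp [hρσ]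
  have hkerB : RingHom.ker ρ ≤ B := hB ▸ le_sup_right
  have hB'B : B' ≤ B := hB ▸ le_sup_left
  have hbb := idealOfVars_pow_five_le (c := c) ha
  have hAB : A ≤ B := fun x hx => (hBmem x).2 (Ideal.mul_le_right (hbb (hA x hx)))
  -- The elements dual to `quadFun a c` and to `cubicFun a c`.
  obtain ⟨w, hw⟩ := hφ' ((quadFun a c).comp ρ.toLinearMap) fun x hx =>
    quadFun_eq_zero_of_mem_pow a c (Ideal.pow_le_pow_right (by norm_num) (hA x hx))
  have hX (j l : Fin 5) := hφ' ((cubicFun a c j l).comp ρ.toLinearMap) fun x hx =>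
    cubicFun_eq_zero_of_mem_pow a c j l (Ideal.pow_le_pow_right (by norm_num) (hA x hx))
  choose X₀ hX₀ using hX
  replace hw (p : P) : φ (w * p) = quadFun a c (ρ p) := (hw p).symm
  replace hX₀ (j l : Fin 5) (p : P) : φ (X₀ j l * p) = cubicFun a c j l (ρ p) := (hX₀ j l p).symm
  have hwB (x : P) : w * x ∈ A ↔ x ∈ B := by
    rw [hBmem, mem_quadIdeal_iff ha hc, hφ]
    constructor
    · intro h r
      rw [← hρσ r, ← map_mul, ← hw, ← mul_assoc, h]
    · intro h p
      rw [mul_assoc, hw, map_mul, h]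
  -- `J = A + (w)`, since `A : w = B`.
  have hJw (x : P) : x ∈ J ↔ ∃ p, x - w * p ∈ A := by
    constructor
    · intro hx
      by_contra hx'
      let W : Submodule k P := A.restrictScalars k ⊔ LinearMap.range (LinearMap.mulLeft k w)
      have hxW : x ∉ W := by
        intro h
        obtain ⟨a, ha, _, ⟨p, rfl⟩, rfl⟩ := Submodule.mem_sup.1 h
        exact hx' ⟨p, by simpa using ha⟩
      obtain ⟨l, hl, hlW⟩ := Submodule.exists_le_ker_of_notMem hxW
      obtain ⟨z, hz⟩ := hφ' l fun a ha => hlW (Submodule.mem_sup_left ha)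
      refine hl ?_
      have hzB : z ∈ B := by
        rw [← hwB, hφ]
        intro p
        rw [mul_right_comm, mul_comm, ← hz]
        exact hlW (Submodule.mem_sup_right ⟨p, rfl⟩)
      rw [hz, mul_comm]
      simpa using (hφ _).1 ((hJ x).1 hx z hzB) 1
    · rintro ⟨p, hp⟩
      refine (hJ x).2 fun b hb => ?_
      have h1 := A.mul_mem_left p ((hwB b).2 hb)
      convert add_mem (A.mul_mem_right b hp) h1 using 1
      ring
  let gen : Fin 5 ⊕ Fin s → P := Sum.elim (fun i => σ (quadForm a c i)) y
  have hgenB' (i : Fin 5) : σ (quadForm a c i) ∈ B' :=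
    hB' ▸ Ideal.mem_map_of_mem σ (quadForm_mem a c i)
  have hgenspan : Ideal.span (Set.range gen) = B := by
    rw [Set.Sum.elim_range, Ideal.span_union, hy, hB, hB', quadIdeal, Ideal.map_span,
      ← Set.range_comp]
    rfl
  have hgen (i) : gen i ∈ B := hgenspan ▸ Ideal.subset_span ⟨i, rfl⟩
  obtain ⟨e, he, heN⟩ := hω.exists_presentation φ hφ hφ' hAB hJ hres gen hgenspan
  -- The projection `G → B'` on the components of the quadrics.
  let χ₀ : (Fin 5 ⊕ Fin s → P) →ₗ[P] B' :=
    (Fintype.linearCombination P fun i : Fin 5 => (⟨σ (quadForm a c i), hgenB' i⟩ : B')).comp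
      (LinearMap.funLeft P P Sum.inl)
  have hχ₀ (u) : (χ₀ u : P) = ∑ i, u (Sum.inl i) * σ (quadForm a c i) := by
    simp [χ₀, Fintype.linearCombination_apply, LinearMap.funLeft_apply]
  have hρχ₀ (u) : ρ (χ₀ u) = ∑ i, ρ (u (Sum.inl i)) * quadForm a c i := by
    simp [hχ₀, hρσ]
  let N : Submodule P (Fin 5 ⊕ Fin s → P) := Submodule.comap (Fintype.linearCombination P gen) A
  have hN (u) : u ∈ N ↔ ∑ i, u i * gen i ∈ A := Iff.rfl
  let G₀ := LinearMap.ker ((B • ⊤ : Submodule P B').mkQ.comp χ₀)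
  have hG₀ (u) : u ∈ G₀ ↔ (χ₀ u : P) ∈ B * B' := by
    rw [LinearMap.mem_ker, LinearMap.comp_apply, Submodule.mkQ_apply, Submodule.Quotient.mk_eq_zero,
      Submodule.mem_smul_top_iff, smul_eq_mul]
  have hsq {p : P} (hp : p ∈ B') (hρp : ρ p ∈ quadIdeal a c * quadIdeal a c) : p ∈ B * B' := by
    rw [← sub_add_cancel p (σ (ρ p))]
    refine add_mem (Ideal.mul_mono_left hkerB ?_) (Ideal.mul_mono_left hB'B ?_)
    · subst hB'
      exact map_sub_mem_ker_mul ρ.toRingHom σ.toRingHom hρσ _ hp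
    · rw [hB', ← Ideal.map_mul]
      exact Ideal.mem_map_of_mem σ hρp
  have hρsq {p : P} (hp : p ∈ B * B') : ρ p ∈ quadIdeal a c * quadIdeal a c := by
    have h1 := Ideal.mem_map_of_mem ρ hp
    rw [Ideal.map_mul] at h1
    have h2 : B.map ρ ≤ quadIdeal a c := Ideal.map_le_iff_le_comap.2 fun x hx => (hBmem x).1 hx
    exact Ideal.mul_mono h2 ((Ideal.map_mono hB'B).trans h2) h1
  let X : Fin 5 → (Fin 5 ⊕ Fin s → P) →ₗ[P] P := fun j =>
    (Fintype.linearCombination P (X₀ j)).comp (LinearMap.funLeft P P Sum.inl)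
  have hX (j u) : X j u = ∑ l, u (Sum.inl l) * X₀ j l := rfl
  have hφX (j u p) : φ (X j u * p) = ∑ l, cubicFun a c j l (ρ (u (Sum.inl l)) * ρ p) := by
    rw [hX, Finset.sum_mul, map_sum]
    refine Finset.sum_congr rfl fun l _ => ?_
    rw [mul_comm (u _), mul_assoc, hX₀, map_mul]
  have hy0 (i : Fin s) : ρ (y i) = 0 := by
    have : y i ∈ RingHom.ker ρ := hy ▸ Ideal.subset_span ⟨i, rfl⟩
    exact this
  refine IsSecondSyzygy.hasDirectSummandIso (A := A) (B := B) (w := w) hJw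
    (fun x hx => (hwB x).1 hx) N G₀ ?_ ?_ ?_ e he (fun u => (heN u).trans (hN u).symm) X ?_ ?_
    (fun j => Sum.elim (fun i => σ (linSyz a c j i)) 0) ?_ ?_
    ((B • ⊤ : Submodule P B').mkQ.comp χ₀) ?_ rfl hZ
  · intro u hu
    refine (hG₀ u).2 (hsq (χ₀ u).2 (hbb ?_))
    have : ρ (χ₀ u) = ρ (∑ i, u i * gen i) := by
      simp [hρχ₀, gen, hy0, hρσ]
    rw [this]
    exact hA _ ((hN u).1 hu)
  · intro u hu
    rw [hG₀, hχ₀]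
    exact sum_mem fun i _ => Ideal.mul_mem_mul (hu _) (hgenB' i)
  · intro u hu
    exact (hN u).2 (sum_mem fun i _ => (hJ _).1 (hu i) _ (hgen i))
  · intro j u hu
    have hu' : ∑ i, ρ (u (Sum.inl i)) * quadForm a c i ∈ idealOfVars (Fin 3) k ^ 4 := by
      rw [← hρχ₀]
      refine (Ideal.mul_mono quadIdeal_le_sq quadIdeal_le_sq).trans_eq ?_ (hρsq ((hG₀ u).1 hu))
      rw [← pow_add]
    have key {b : MvPolynomial (Fin 3) k} (hb : b ∈ quadIdeal a c) (q : MvPolynomial (Fin 3) k) :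
        ∑ l, cubicFun a c j l (ρ (u (Sum.inl l)) * (b * q)) = 0 := by
      induction hb using Submodule.span_induction generalizing q with
      | mem b hb =>
        obtain ⟨m, rfl⟩ := hb
        calc _ = ∑ l, cubicFun' a c j m ((ρ (u (Sum.inl l)) * quadForm a c l) * q) :=
              Finset.sum_congr rfl fun l _ => by
                rw [mul_left_comm, cubicFun_quadForm_mul ha hc]
                congr 1; ring
          _ = 0 := by
              rw [← map_sum, ← Finset.sum_mul]
              exact cubicFun'_eq_zero_of_mem_pow a c j m (Ideal.mul_mem_right _ _ hu')
      | zero => simp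
      | add b b' _ _ h h' =>
        simp only [add_mul, mul_add, map_add, Finset.sum_add_distrib] at h h' ⊢
        rw [h, h', add_zero]
      | smul r b _ h =>
        rw [← h (r * q)]
        refine Finset.sum_congr rfl fun l _ => ?_
        congr 1
        rw [smul_eq_mul]; ring
    refine (hJ _).2 fun b hb => (hφ _).2 fun p => ?_
    rw [mul_assoc, hφX, map_mul]
    exact key ((hBmem b).1 hb) _
  · intro j u
    rw [hX, map_sum]
    refine sum_mem fun l _ => ?_
    rw [map_mul]
    refine Ideal.mul_mem_left _ _ ?_
    by_contra hunit
    rw [IsLocalRing.mem_maximalIdeal, mem_nonunits_iff, not_not] at hunit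
    obtain ⟨z, hz⟩ := hunit.exists_right_inv
    obtain ⟨z, rfl⟩ := Ideal.Quotient.mk_surjective z
    rw [← map_mul, ← map_one (Ideal.Quotient.mk J), Ideal.Quotient.mk_eq_mk_iff_sub_mem] at hz
    -- If `X₀ j l` were a unit modulo `J`, then `X 0 ^ 4`, which lies in `B` and is killed by
    -- `X₀ j l` modulo `A`, would be in `A`, in spite of its degree.
    have hq : (MvPolynomial.X 0 ^ 4 : MvPolynomial (Fin 3) k) ∈ idealOfVars (Fin 3) k ^ 4 :=
      Ideal.pow_mem_pow (X_mem_idealOfVars 0) 4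
    have hqB : σ (MvPolynomial.X 0 ^ 4) ∈ B := by
      rw [hBmem, hρσ]
      exact Ideal.mul_le_right (idealOfVars_pow_three_le ha
        (Ideal.pow_le_pow_right (by norm_num) hq))
    have h1 : X₀ j l * σ (MvPolynomial.X 0 ^ 4) ∈ A := by
      rw [hφ]
      intro p
      rw [mul_assoc, hX₀, map_mul, hρσ]
      exact cubicFun_eq_zero_of_mem_pow a c j l (Ideal.mul_mem_right _ _ hq)
    have h2 : σ (MvPolynomial.X 0 ^ 4) ∈ A := by
      convert sub_mem (A.mul_mem_left z h1) ((hJ _).1 hz _ hqB) using 1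
      ring
    have h3 := hA _ h2
    rw [hρσ, X_pow_eq_monomial, monomial_mem_pow_idealOfVars_iff _ _ one_ne_zero,
      Finsupp.degree_single] at h3
    omega
  · intro j
    rw [hN]
    have : ∑ i, σ (linSyz a c j i) * σ (quadForm a c i) = 0 := by
      simp only [← map_mul, ← map_sum, sum_linSyz_mul_quadForm, map_zero]
    simp [gen, this]
  · intro u
    refine ⟨Sum.elim 0 fun i => - u (Sum.inr i), ?_, ?_⟩
    · rw [hG₀, hχ₀]
      simp
    · rintro (i | i)
      · rw [hφ]
        intro p
        have h1 (j) : φ (X j u * σ (linSyz a c j i) * p) =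
            ∑ l, cubicFun a c j l (linSyz a c j i * (ρ (u (Sum.inl l)) * ρ p)) := by
          rw [mul_assoc, hφX, map_mul, hρσ]
          refine Finset.sum_congr rfl fun l _ => ?_
          congr 1; ring
        have h2 : ∑ j, φ (X j u * σ (linSyz a c j i) * p) =
            quadFun a c (ρ (u (Sum.inl i)) * ρ p) := by
          simp only [h1]
          rw [Finset.sum_comm]
          simp only [sum_cubicFun_linSyz_mul ha hc]
          simp
        simp only [Sum.elim_inl, Pi.zero_apply, mul_zero, sub_zero, sub_mul, Finset.sum_mul,
          map_sub, map_sum]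
        rw [h2, mul_assoc, hw, map_mul ρ, sub_self]
      · simp
  · refine (Submodule.mkQ_surjective _).comp fun x => ?_
    obtain ⟨x, hx⟩ := x
    have hx' := hx
    rw [hB', quadIdeal, Ideal.map_span, ← Set.range_comp] at hx'
    obtain ⟨v, hv⟩ := (Submodule.mem_span_range_iff_exists_fun P).1 hx'
    refine ⟨Sum.elim v 0, Subtype.ext ?_⟩
    rw [hχ₀]
    simpa using hv

end Core

/-! ### Orthogonal bases in dimension three -/

section OrthogonalBasis

variable {k V : Type*} [Field k] [AddCommGroup V] [Module k V]

theorem exists_notMem_span_pair (hV : Module.finrank k V = 3) (e f : V) :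
    ∃ g, g ∉ Submodule.span k (Set.range ![f, e]) := by
  by_contra! h
  have h1 := finrank_range_le_card (R := k) ![f, e]
  have htop : Submodule.span k (Set.range ![f, e]) = ⊤ := eq_top_iff.2 fun x _ => h x
  rw [Set.finrank, htop, finrank_top, hV] at h1
  simp at h1

theorem eq_zero_of_orthogonal_triple (hV : Module.finrank k V = 3) (β : V →ₗ[k] V →ₗ[k] k)
    (hβ : ∀ x, (∀ y, β x y = 0) → x = 0) {e f g x : V}
    (hli : LinearIndependent k ![g, f, e]) (he : β x e = 0) (hf : β x f = 0)
    (hg : β x g = 0) : x = 0 := by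
  have : FiniteDimensional k V := Module.finite_of_finrank_pos (by omega)
  refine hβ x fun y => ?_
  have hspan := hli.span_eq_top_of_card_eq_finrank' (by simp [hV])
  have hle : Submodule.span k (Set.range ![g, f, e]) ≤ LinearMap.ker (β x) := by
    rw [Submodule.span_le]
    rintro _ ⟨i, rfl⟩
    fin_cases i <;> simpa
  exact hle (hspan ▸ Submodule.mem_top)

/-- A nondegenerate symmetric bilinear form on a three-dimensional space is diagonalizable, in
every characteristic. -/
theorem exists_orthogonal_triple (hV : Module.finrank k V = 3) (β : V →ₗ[k] V →ₗ[k] k)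
    (hsymm : ∀ x y, β x y = β y x) (hβ : ∀ x, (∀ y, β x y = 0) → x = 0) :
    ∃ v : Fin 3 → V, LinearIndependent k v ∧ (∀ i j, i ≠ j → β (v i) (v j) = 0) ∧
      ∀ i, β (v i) (v i) ≠ 0 := by
  have hnt : Nontrivial V := Module.nontrivial_of_finrank_pos (R := k) (by omega)
  have hpair {x y : V} (hx : x ≠ 0) (hy : ∀ t : k, t • x ≠ y) : LinearIndependent k ![y, x] := by
    rw [linearIndependent_fin2]
    exact ⟨hx, hy⟩
  -- There is an anisotropic vector, since alternating forms in odd dimension are degenerate.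
  obtain ⟨v, hv⟩ : ∃ v, β v v ≠ 0 := by
    by_contra! halt
    have hanti (x y : V) : β x y = - β y x := by
      have := halt (x + y)
      simp only [map_add, LinearMap.add_apply, halt, zero_add, add_zero] at this
      exact eq_neg_of_add_eq_zero_right this
    obtain ⟨e, he⟩ := exists_ne (0 : V)
    obtain ⟨f, hf⟩ : ∃ f, β e f ≠ 0 := by
      by_contra! h
      exact he (hβ e h)
    have hfe : LinearIndependent k ![f, e] := hpair he fun t ht => hf (by
      rw [← ht, map_smul, halt, smul_zero])
    obtain ⟨g, hg⟩ := exists_notMem_span_pair hV (k := k) e f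
    have hli : LinearIndependent k ![g, f, e] := linearIndependent_finCons.2 ⟨hfe, hg⟩
    let g' := g - (β g f / β e f) • e + (β g e / β e f) • f
    have hg' : g' = 0 := by
      have h1 : β g' e = 0 := by
        simp only [g', map_add, map_sub, map_smul, LinearMap.add_apply, LinearMap.sub_apply,
          LinearMap.smul_apply, smul_eq_mul, halt, hanti f e]
        field_simp; ring
      have h2 : β g' f = 0 := by
        simp only [g', map_add, map_sub, map_smul, LinearMap.add_apply, LinearMap.sub_apply,
          LinearMap.smul_apply, smul_eq_mul, halt]
        field_simp; ring
      refine eq_zero_of_orthogonal_triple hV β hβ hli h1 h2 ?_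
      have h3 : g = g' + (β g f / β e f) • e - (β g e / β e f) • f := by simp only [g']; abel
      rw [h3, map_sub, map_add, map_smul, map_smul, h1, h2, halt]
      simp
    refine hg ?_
    have h3 : g = (β g f / β e f) • e - (β g e / β e f) • f := by
      rw [← sub_eq_zero, ← hg']; simp only [g']; abel
    rw [h3]
    exact sub_mem (Submodule.smul_mem _ _ (Submodule.subset_span ⟨1, rfl⟩))
      (Submodule.smul_mem _ _ (Submodule.subset_span ⟨0, rfl⟩))
  -- An orthogonal pair of anisotropic vectors. If `β` is alternating on the orthogonal complement
  -- of `v`, a vector `v + x` and a vector `v - t • y` with `x, y` in the complement will do.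
  obtain ⟨v, w, hv, hw, hvw⟩ : ∃ v w, β v v ≠ 0 ∧ β w w ≠ 0 ∧ β v w = 0 := by
    by_cases h : ∃ w, β v w = 0 ∧ β w w ≠ 0
    · obtain ⟨w, h1, h2⟩ := h
      exact ⟨v, w, hv, h2, h1⟩
    push Not at h
    let π (x : V) : V := x - (β v x / β v v) • v
    have hπ (x : V) : β v (π x) = 0 := by
      simp only [π, map_sub, map_smul, smul_eq_mul]
      field_simp; ring
    have hv0 : v ≠ 0 := by rintro rfl; simp at hv
    obtain ⟨x, hx⟩ := exists_notMem_span_pair hV (k := k) v v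
    have he0 : π x ≠ 0 := by
      intro h0
      refine hx ?_
      rw [sub_eq_zero.1 h0]
      exact Submodule.smul_mem _ _ (Submodule.subset_span ⟨0, rfl⟩)
    obtain ⟨y, hy⟩ : ∃ y, β (π x) y ≠ 0 := by
      by_contra! h
      exact he0 (hβ _ h)
    have hxy : β (π x) (π y) = β (π x) y := by
      conv_lhs => rw [show π y = y - (β v y / β v v) • v from rfl]
      rw [map_sub, map_smul, hsymm (π x) v, hπ, smul_zero, sub_zero]
    have hex := h _ (hπ x)
    have hey := h _ (hπ y)
    have hxv : β (π x) v = 0 := by rw [hsymm, hπ]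
    have hyv : β (π y) v = 0 := by rw [hsymm, hπ]
    refine ⟨v + π x, v - (β v v / β (π x) y) • π y, ?_, ?_, ?_⟩
    · simpa only [map_add, LinearMap.add_apply, hπ, hxv, hex, add_zero] using hv
    · simpa only [map_sub, map_smul, LinearMap.sub_apply, LinearMap.smul_apply, hπ, hyv, hey,
        smul_zero, sub_zero] using hv
    · simp only [map_add, map_sub, map_smul, LinearMap.add_apply, hπ, hxv, hxy, smul_eq_mul]
      field_simp; ring
  -- Any vector outside the span of the pair yields the third vector.
  have hwv : β w v = 0 := by rw [hsymm, hvw]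
  have hpr : LinearIndependent k ![w, v] := by
    refine hpair (by rintro rfl; simp at hv) fun t ht => hw ?_
    rw [← ht, map_smul, ht, hwv, smul_zero]
  obtain ⟨x, hx⟩ := exists_notMem_span_pair hV (k := k) v w
  let u := x - (β v x / β v v) • v - (β w x / β w w) • w
  have hvu : β v u = 0 := by
    simp only [u, map_sub, map_smul, smul_eq_mul, hvw]
    field_simp; ring
  have hwu : β w u = 0 := by
    simp only [u, map_sub, map_smul, smul_eq_mul, hwv]
    field_simp; ring
  have hu : u ∉ Submodule.span k (Set.range ![w, v]) := by
    intro hu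
    refine hx ?_
    have : x = u + (β v x / β v v) • v + (β w x / β w w) • w := by simp only [u]; abel
    rw [this]
    exact add_mem (add_mem hu (Submodule.smul_mem _ _ (Submodule.subset_span ⟨1, rfl⟩)))
      (Submodule.smul_mem _ _ (Submodule.subset_span ⟨0, rfl⟩))
  have hli : LinearIndependent k ![u, w, v] := linearIndependent_finCons.2 ⟨hpr, hu⟩
  have huv : β u v = 0 := by rw [hsymm, hvu]
  have huw : β u w = 0 := by rw [hsymm, hwu]
  have huu : β u u ≠ 0 := by
    intro h0
    refine hu ?_
    rw [eq_zero_of_orthogonal_triple hV β hβ hli huv huw h0]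
    exact zero_mem _
  refine ⟨![u, w, v], hli, ?_, ?_⟩
  · intro i j hij
    fin_cases i <;> fin_cases j <;> first | exact absurd rfl hij | simpa
  · intro i
    fin_cases i <;> simpa

end OrthogonalBasis

/-! ### Quadratic forms and linear substitutions -/

section Reduction

variable {k : Type u} [Field k]

theorem homogeneousSubmodule_two_eq_span :
    homogeneousSubmodule (Fin 3) k 2 =
      Submodule.span k
        (Set.range fun ij : Fin 3 × Fin 3 => (X ij.1 * X ij.2 : MvPolynomial (Fin 3) k)) := by
  rw [← homogeneousSubmodule_one_pow, homogeneousSubmodule_one_eq_span_X, pow_two,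
    Submodule.span_mul_span]
  congr 1
  ext p
  constructor
  · rintro ⟨_, ⟨i, rfl⟩, _, ⟨j, rfl⟩, rfl⟩
    exact ⟨(i, j), rfl⟩
  · rintro ⟨⟨i, j⟩, rfl⟩
    exact ⟨_, ⟨i, rfl⟩, _, ⟨j, rfl⟩, rfl⟩

theorem finrank_homogeneousSubmodule_two_le :
    Module.finrank k (homogeneousSubmodule (Fin 3) k 2) ≤ 6 := by
  let f : Sym2 (Fin 3) → MvPolynomial (Fin 3) k :=
    Sym2.lift ⟨fun i j => X i * X j, fun i j => mul_comm _ _⟩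
  have hf : homogeneousSubmodule (Fin 3) k 2 = Submodule.span k (Set.range f) := by
    rw [homogeneousSubmodule_two_eq_span]
    congr 1
    ext p
    constructor
    · rintro ⟨⟨i, j⟩, rfl⟩
      exact ⟨s(i, j), rfl⟩
    · rintro ⟨z, rfl⟩
      induction z with | _ i j
      exact ⟨(i, j), rfl⟩
  have hcard : Fintype.card (Sym2 (Fin 3)) = 6 := by rw [Sym2.card, Fintype.card_fin]; rfl
  rw [hf, ← hcard]
  exact finrank_range_le_card f

/-- Five linearly independent quadratic forms in three variables are cut out, among all quadratic
forms, by one linear functional. -/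
theorem exists_functional_of_quadratic_forms (q : Fin 5 → MvPolynomial (Fin 3) k)
    (hq : ∀ i, (q i).IsHomogeneous 2) (hqind : LinearIndependent k q) :
    ∃ ψ : MvPolynomial (Fin 3) k →ₗ[k] k, (∀ i, ψ (q i) = 0) ∧
      ∀ p, p.IsHomogeneous 2 → ψ p = 0 → p ∈ Submodule.span k (Set.range q) := by
  by_cases h : ∀ p : MvPolynomial (Fin 3) k,
      p.IsHomogeneous 2 → p ∈ Submodule.span k (Set.range q)
  · exact ⟨0, by simp, fun p hp _ => h p hp⟩
  push Not at h
  obtain ⟨p₀, hp₀, hp₀q⟩ := h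
  obtain ⟨ψ, hψ, hψq⟩ := Submodule.exists_le_ker_of_notMem hp₀q
  have hψq' (i : Fin 5) : ψ (q i) = 0 := hψq (Submodule.subset_span ⟨i, rfl⟩)
  refine ⟨ψ, hψq', fun p hp hpψ => ?_⟩
  have hli : LinearIndependent k (Fin.cons p₀ q : Fin 6 → MvPolynomial (Fin 3) k) :=
    linearIndependent_finCons.2 ⟨hqind, hp₀q⟩
  have : FiniteDimensional k (homogeneousSubmodule (Fin 3) k 2) :=
    Module.Finite.iff_fg.2 (homogeneousSubmodule_fg _ _ _)
  have hle : Submodule.span k (Set.range (Fin.cons p₀ q : Fin 6 → MvPolynomial (Fin 3) k)) ≤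
      homogeneousSubmodule (Fin 3) k 2 := by
    rw [Submodule.span_le]
    rintro _ ⟨i, rfl⟩
    exact Fin.cases (motive := fun i => (Fin.cons p₀ q : Fin 6 → MvPolynomial (Fin 3) k) i ∈
      homogeneousSubmodule (Fin 3) k 2) hp₀ hq i
  have heq := Submodule.eq_of_le_of_finrank_le hle (by
    rw [finrank_span_eq_card hli]
    simpa using finrank_homogeneousSubmodule_two_le)
  have hp' : p ∈ Submodule.span k (Set.range (Fin.cons p₀ q : Fin 6 → MvPolynomial (Fin 3) k)) :=
    heq ▸ hp
  rw [Fin.range_cons, Submodule.mem_span_insert] at hp'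
  obtain ⟨t, v, hv, rfl⟩ := hp'
  have hv0 : ψ v = 0 := hψq hv
  rw [map_add, map_smul, hv0, add_zero, smul_eq_mul, mul_eq_zero, or_iff_left hψ] at hpψ
  rw [hpψ, zero_smul, zero_add]
  exact hv

/-- The linear form in `X₀, X₁, X₂` with the given coefficients. -/
noncomputable def linForm : (Fin 3 → k) →ₗ[k] MvPolynomial (Fin 3) k :=
  Fintype.linearCombination k X

theorem linForm_single (i : Fin 3) : linForm (Pi.single i 1 : Fin 3 → k) = X i := by
  simp [linForm, Fintype.linearCombination_apply_single]

theorem linForm_isHomogeneous (u : Fin 3 → k) : (linForm u).IsHomogeneous 1 := by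
  rw [linForm, Fintype.linearCombination_apply]
  exact IsHomogeneous.sum _ _ _ fun i _ => (homogeneousSubmodule (Fin 3) k 1).smul_mem _
    (isHomogeneous_X k i)

theorem linForm_mem (u : Fin 3 → k) : linForm u ∈ idealOfVars (Fin 3) k := by
  rw [linForm, Fintype.linearCombination_apply]
  exact sum_mem fun i _ => Submodule.smul_of_tower_mem _ _ (X_mem_idealOfVars i)

theorem linForm_eq_zero_of_mem_sq {u : Fin 3 → k} (hu : linForm u ∈ idealOfVars (Fin 3) k ^ 2) :
    u = 0 := by
  classical
  ext i
  have := (mem_pow_idealOfVars_iff' _ _).1 hu (Finsupp.single i 1) (by simp)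
  simpa [linForm, Fintype.linearCombination_apply, coeff_sum, coeff_X, Finsupp.single_left_inj]
    using this

/-- The linear substitution of variables attached to a linear endomorphism `g` of the space of
linear forms: the variable `X i` is sent to `g` of itself. -/
noncomputable def linSubst (g : (Fin 3 → k) →ₗ[k] (Fin 3 → k)) :
    MvPolynomial (Fin 3) k →ₐ[k] MvPolynomial (Fin 3) k :=
  aeval fun i => linForm (g (Pi.single i 1))

theorem linSubst_linForm (g : (Fin 3 → k) →ₗ[k] (Fin 3 → k)) (u : Fin 3 → k) :
    linSubst g (linForm u) = linForm (g u) := by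
  have : (linSubst g).toLinearMap.comp linForm = linForm.comp g := by
    refine LinearMap.pi_ext' fun i => LinearMap.ext_ring ?_
    simp [linForm_single, linSubst]
  exact LinearMap.congr_fun this u

theorem linSubst_linSubst {g h : (Fin 3 → k) →ₗ[k] (Fin 3 → k)} (hgh : g.comp h = LinearMap.id)
    (p : MvPolynomial (Fin 3) k) : linSubst g (linSubst h p) = p := by
  have : (linSubst g).comp (linSubst h) = AlgHom.id k _ := by
    refine algHom_ext fun i => ?_
    rw [AlgHom.comp_apply, ← linForm_single, linSubst_linForm, linSubst_linForm,
      ← LinearMap.comp_apply g h, hgh, LinearMap.id_apply, AlgHom.id_apply]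
  exact AlgHom.congr_fun this p

theorem linSubst_isHomogeneous (g : (Fin 3 → k) →ₗ[k] (Fin 3 → k)) {p : MvPolynomial (Fin 3) k}
    (hp : p.IsHomogeneous 2) : (linSubst g p).IsHomogeneous 2 := by
  have hp' : p ∈ homogeneousSubmodule (Fin 3) k 2 := hp
  have h : homogeneousSubmodule (Fin 3) k 2 ≤
      (homogeneousSubmodule (Fin 3) k 2).comap (linSubst g).toLinearMap := by
    conv_lhs => rw [homogeneousSubmodule_two_eq_span]
    rw [Submodule.span_le]
    rintro _ ⟨⟨i, j⟩, rfl⟩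
    simpa [linSubst] using (linForm_isHomogeneous _).mul (linForm_isHomogeneous _)
  exact h hp'

end Reduction

/-! ### Reduction to the normal form -/

section NormalForm

variable {k : Type u} [Field k] {a c : k}

theorem isHomogeneous_two_mem_sq {p : MvPolynomial (Fin 3) k} (hp : p.IsHomogeneous 2) :
    p ∈ idealOfVars (Fin 3) k ^ 2 := by
  rw [mem_pow_idealOfVars_iff']
  intro x hx
  exact hp.coeff_eq_zero (by omega)

theorem quadFun_X_mul_X (i j : Fin 3) :
    quadFun a c (X i * X j) = if i = j then (![1, a, c] : Fin 3 → k) i else 0 := by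
  have : (X i * X j : MvPolynomial (Fin 3) k) = X i * (X j * C 1) := by simp
  rw [this]
  fin_cases i <;> fin_cases j <;>
  simp [-map_one, -C_1, quadFun, coeffFun_X_zero_mul, coeffFun_X_one_mul, coeffFun_X_two_mul,
    coeffFun_zero_X_zero_mul, coeffFun_zero_X_one_mul, coeffFun_zero_X_two_mul, coeffFun_C]

theorem sub_C_constantCoeff_mem (r : MvPolynomial (Fin 3) k) :
    r - C (constantCoeff r) ∈ idealOfVars (Fin 3) k := by
  induction r using MvPolynomial.induction_on with
  | C r => simp
  | add p q hp hq =>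
    convert add_mem hp hq using 1
    simp only [map_add]; ring
  | mul_X p j hp => simpa using Ideal.mul_mem_left _ _ (X_mem_idealOfVars j)

theorem quadFun_mul_of_isHomogeneous_two {p : MvPolynomial (Fin 3) k} (hp : p.IsHomogeneous 2)
    (r : MvPolynomial (Fin 3) k) :
    quadFun a c (p * r) = constantCoeff r * quadFun a c p := by
  have h : quadFun a c (p * (r - C (constantCoeff r))) = 0 := by
    refine quadFun_eq_zero_of_mem_pow a c ?_
    rw [pow_succ]
    exact Ideal.mul_mem_mul (isHomogeneous_two_mem_sq hp) (sub_C_constantCoeff_mem r)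
  rw [mul_sub, map_sub, sub_eq_zero, mul_comm p (C _), ← smul_eq_C_mul, map_smul, smul_eq_mul] at h
  exact h

theorem quadForm_isHomogeneous (i : Fin 5) : (quadForm a c i).IsHomogeneous 2 := by
  have h (i j : Fin 3) : (X i * X j : MvPolynomial (Fin 3) k).IsHomogeneous 2 :=
    (isHomogeneous_X k i).mul (isHomogeneous_X k j)
  have h' (r : k) (i j : Fin 3) : (C r * (X i * X j) : MvPolynomial (Fin 3) k).IsHomogeneous 2 := by
    rw [← smul_eq_C_mul]
    exact (homogeneousSubmodule (Fin 3) k 2).smul_mem r (h i j)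
  fin_cases i
  exacts [h 1 2, h 0 2, h 0 1, (h' a 0 0).sub (h 1 1), (h' c 0 0).sub (h 2 2)]

/-- If a functional `ψ` cutting out `q₁, …, q₅` among the quadratic forms has, after the
substitution `g`, the diagonal Gram matrix with entries `1, a, c`, then `g` carries
`quadIdeal a c` to the ideal of `q₁, …, q₅`. -/
theorem map_quadIdeal_eq_span (ha : a ≠ 0) (hc : c ≠ 0) {g h : (Fin 3 → k) →ₗ[k] (Fin 3 → k)}
    (hgh : g.comp h = LinearMap.id)
    {q : Fin 5 → MvPolynomial (Fin 3) k} (hq : ∀ i, (q i).IsHomogeneous 2)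
    {ψ : MvPolynomial (Fin 3) k →ₗ[k] k} (hψq : ∀ i, ψ (q i) = 0)
    (hψ : ∀ p, p.IsHomogeneous 2 → ψ p = 0 → p ∈ Submodule.span k (Set.range q))
    (hgram : ∀ i j : Fin 3, ψ (linForm (g (Pi.single i 1)) * linForm (g (Pi.single j 1))) =
      if i = j then (![1, a, c] : Fin 3 → k) i else 0) :
    (quadIdeal a c).map (linSubst g) = Ideal.span (Set.range q) := by
  have hquad {p : MvPolynomial (Fin 3) k} (hp : p.IsHomogeneous 2) :
      ψ (linSubst g p) = quadFun a c p := by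
    have h : homogeneousSubmodule (Fin 3) k 2 ≤
        LinearMap.eqLocus (ψ.comp (linSubst g).toLinearMap) (quadFun a c) := by
      rw [homogeneousSubmodule_two_eq_span, Submodule.span_le]
      rintro _ ⟨⟨i, j⟩, rfl⟩
      change ψ (linSubst g (X i * X j)) = quadFun a c (X i * X j)
      rw [quadFun_X_mul_X, ← hgram, map_mul, linSubst, aeval_X, aeval_X]
    exact h hp
  refine le_antisymm ?_ ?_
  · rw [quadIdeal, Ideal.map_span, Ideal.span_le]
    rintro _ ⟨_, ⟨i, rfl⟩, rfl⟩
    refine Submodule.span_le_restrictScalars k _ _ (hψ _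
      (linSubst_isHomogeneous g (quadForm_isHomogeneous i)) ?_)
    have h := quadFun_mul_eq_zero (quadForm_mem a c i) 1
    rw [mul_one] at h
    exact (hquad (quadForm_isHomogeneous i)).trans h
  · rw [Ideal.span_le]
    rintro _ ⟨i, rfl⟩
    rw [SetLike.mem_coe, ← linSubst_linSubst hgh (q i)]
    refine Ideal.mem_map_of_mem _ ((mem_quadIdeal_iff ha hc _).2 fun r => ?_)
    have hi := linSubst_isHomogeneous h (hq i)
    rw [quadFun_mul_of_isHomogeneous_two hi, ← hquad hi, linSubst_linSubst hgh, hψq, mul_zero]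

/-- A functional on quadratic forms whose bilinear form on the linear forms is nondegenerate is
brought to diagonal form by an invertible linear substitution. The factor `t` normalizes the first
diagonal entry to `1`. -/
theorem exists_linear_substitution (ψ : MvPolynomial (Fin 3) k →ₗ[k] k)
    (hψ : ∀ u, (∀ v, ψ (linForm u * linForm v) = 0) → u = 0) :
    ∃ (g : (Fin 3 → k) ≃ₗ[k] (Fin 3 → k)) (t a c : k), t ≠ 0 ∧ a ≠ 0 ∧ c ≠ 0 ∧
      ∀ i j : Fin 3, t * ψ (linForm (g (Pi.single i 1)) * linForm (g (Pi.single j 1))) =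
        if i = j then (![1, a, c] : Fin 3 → k) i else 0 := by
  let β : (Fin 3 → k) →ₗ[k] (Fin 3 → k) →ₗ[k] k :=
    ((LinearMap.mul k (MvPolynomial (Fin 3) k)).compl₁₂ linForm linForm).compr₂ ψ
  have hβ (u v) : β u v = ψ (linForm u * linForm v) := rfl
  have h3 : Module.finrank k (Fin 3 → k) = 3 := by simp
  obtain ⟨v, hv, horth, hdiag⟩ := exists_orthogonal_triple h3 β
    (fun u v => by rw [hβ, hβ, mul_comm]) hψ
  let b := basisOfLinearIndependentOfCardEqFinrank hv (by simp)
  have hb (i) : (Pi.basisFun k (Fin 3)).equiv b (Equiv.refl _) (Pi.single i 1) = v i := by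
    rw [← Pi.basisFun_apply, Module.Basis.equiv_apply]
    simp [b]
  refine ⟨(Pi.basisFun k (Fin 3)).equiv b (Equiv.refl _), (β (v 0) (v 0))⁻¹,
    (β (v 0) (v 0))⁻¹ * β (v 1) (v 1), (β (v 0) (v 0))⁻¹ * β (v 2) (v 2), inv_ne_zero (hdiag 0),
    mul_ne_zero (inv_ne_zero (hdiag 0)) (hdiag 1), mul_ne_zero (inv_ne_zero (hdiag 0)) (hdiag 2),
    fun i j => ?_⟩
  rw [hb, hb, ← hβ]
  split_ifs with hij
  · subst hij
    fin_cases i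
    · exact inv_mul_cancel₀ (hdiag 0)
    · rfl
    · rfl
  · rw [horth i j hij, mul_zero]

end NormalForm

/-! ### Duality for Gorenstein quotients of polynomial rings -/

section Gorenstein

/-- Macaulay duality for an Artinian Gorenstein quotient of a polynomial ring: the ideal is the
annihilator of a functional `φ`, and all functionals vanishing on the ideal are multiples of
`φ`. -/
theorem exists_dual_functional {k : Type u} [Field k] {σ : Type} [Finite σ]
    (A : Ideal (MvPolynomial σ k)) [IsArtinianRing (MvPolynomial σ k ⧸ A)]
    (hA : IsGorensteinLocalRing (MvPolynomial σ k ⧸ A)) :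
    ∃ φ : MvPolynomial σ k →ₗ[k] k, (∀ x, x ∈ A ↔ ∀ p, φ (x * p) = 0) ∧
      ∀ l : MvPolynomial σ k →ₗ[k] k, (∀ x ∈ A, l x = 0) → ∃ x, ∀ p, l p = φ (x * p) := by
  have := hA.isLocalRing
  have := Module.finite_of_isArtinianRing k (MvPolynomial σ k ⧸ A)
  obtain ⟨φ, hφ, hφ'⟩ := exists_perfect_functional k (MvPolynomial σ k ⧸ A) hA.injective_self
  refine ⟨φ.comp (Ideal.Quotient.mkₐ k A).toLinearMap, fun x => ⟨fun hx p => ?_, fun h => ?_⟩,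
    fun l hl => ?_⟩
  · have : Ideal.Quotient.mk A (x * p) = 0 :=
      Ideal.Quotient.eq_zero_iff_mem.2 (A.mul_mem_right p hx)
    simp [this]
  · refine Ideal.Quotient.eq_zero_iff_mem.1 (hφ _ fun y => ?_)
    obtain ⟨p, rfl⟩ := Ideal.Quotient.mk_surjective y
    exact h p
  · obtain ⟨t, ht⟩ := LinearMap.exists_rightInverse_of_surjective
      (Ideal.Quotient.mkₐ k A).toLinearMap
      (LinearMap.range_eq_top.2 (Ideal.Quotient.mkₐ_surjective k A))
    obtain ⟨x, hx⟩ := hφ' (l.comp t)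
    obtain ⟨x, rfl⟩ := Ideal.Quotient.mk_surjective x
    refine ⟨x, fun p => ?_⟩
    have h1 : Ideal.Quotient.mk A (t (Ideal.Quotient.mk A p)) = Ideal.Quotient.mk A p :=
      LinearMap.congr_fun ht (Ideal.Quotient.mk A p)
    have h2 := hl _ ((Ideal.Quotient.mk_eq_mk_iff_sub_mem _ _).1 h1)
    rw [map_sub, sub_eq_zero] at h2
    rw [← h2]
    exact hx (Ideal.Quotient.mk A p)

end Gorenstein

/-! ### The polynomial ring in the variables `X` and `Y` -/

section XYVariables

variable {k : Type u} [Field k]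

theorem maxHomogIdeal_eq_idealOfVars (σ : Type v) : maxHomogIdeal σ k = idealOfVars σ k := by
  rw [maxHomogIdeal, homogeneousSubmodule_one_eq_span_X]
  refine le_antisymm (Ideal.span_le.2 ?_) (Ideal.span_mono Submodule.subset_span)
  exact Submodule.span_le_restrictScalars k (MvPolynomial σ k) (Set.range X)

/-- A local ring `P ⧸ J` with `A ≤ J` has residue field `k` if `P ⧸ A` is Artinian local and `A` lies
in the ideal of the variables: the variables are nilpotent modulo `A`. -/
theorem exists_sub_algebraMap_mem_maximalIdeal {σ : Type*} {A J : Ideal (MvPolynomial σ k)}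
    (hAJ : A ≤ J) (hA : A ≤ idealOfVars σ k) [IsLocalRing (MvPolynomial σ k ⧸ A)]
    [IsArtinianRing (MvPolynomial σ k ⧸ A)] [IsLocalRing (MvPolynomial σ k ⧸ J)]
    (r : MvPolynomial σ k ⧸ J) :
    ∃ t : k, r - algebraMap k (MvPolynomial σ k ⧸ J) t ∈
      IsLocalRing.maximalIdeal (MvPolynomial σ k ⧸ J) := by
  have hX (i : σ) : Ideal.Quotient.mk J (X i) ∈
      IsLocalRing.maximalIdeal (MvPolynomial σ k ⧸ J) := by
    have h1 : Ideal.Quotient.mk A (X i) ∈ IsLocalRing.maximalIdeal (MvPolynomial σ k ⧸ A) := by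
      rw [IsLocalRing.mem_maximalIdeal, mem_nonunits_iff]
      intro hu
      obtain ⟨z, hz⟩ := hu.exists_right_inv
      obtain ⟨z, rfl⟩ := Ideal.Quotient.mk_surjective z
      rw [← map_mul, ← map_one (Ideal.Quotient.mk A), Ideal.Quotient.mk_eq_mk_iff_sub_mem] at hz
      have hle : idealOfVars σ k ≤ RingHom.ker (constantCoeff (R := k) (σ := σ)) := by
        rw [idealOfVars, Ideal.span_le]
        rintro _ ⟨j, rfl⟩
        simp [RingHom.mem_ker]
      have := hle (hA hz)
      simp [RingHom.mem_ker] at this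
    obtain ⟨n, hn⟩ := (isArtinianRing_iff_isNilpotent_maximalIdeal _).1
      (inferInstance : IsArtinianRing (MvPolynomial σ k ⧸ A))
    have h2 : Ideal.Quotient.mk A (X i) ^ n = 0 := by
      have := Ideal.pow_mem_pow h1 n
      rwa [hn] at this
    have h3 : Ideal.Quotient.mk J (X i) ^ n = 0 := by
      rw [← map_pow, Ideal.Quotient.eq_zero_iff_mem] at h2 ⊢
      exact hAJ h2
    exact Ideal.IsPrime.mem_of_pow_mem inferInstance n (h3 ▸ zero_mem _)
  obtain ⟨p, rfl⟩ := Ideal.Quotient.mk_surjective r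
  refine ⟨constantCoeff p, ?_⟩
  change Ideal.Quotient.mk J p - Ideal.Quotient.mk J (C (constantCoeff p)) ∈ _
  induction p using MvPolynomial.induction_on with
  | C r => simp
  | add p q hp hq =>
    convert add_mem hp hq using 1
    simp only [map_add]; ring
  | mul_X p j hp => simpa using Ideal.mul_mem_left _ _ (hX j)

variable {s : ℕ}

/-- The substitution `X_j ↦ h (X_j)`, `Y_j ↦ 0`, for a linear endomorphism `h` of the space of
linear forms in the `X`'s. It is a retraction of the linear substitution attached to an inverse of `h`. -/
noncomputable def retractX (s : ℕ) (h : (Fin 3 → k) →ₗ[k] (Fin 3 → k)) :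
    PolyXY k s →ₐ[k] MvPolynomial (Fin 3) k :=
  aeval (Sum.elim (fun j => linForm (h (Pi.single j 1))) 0)

theorem retractX_rename (h : (Fin 3 → k) →ₗ[k] (Fin 3 → k)) (p : MvPolynomial (Fin 3) k) :
    retractX s h (rename Sum.inl p) = linSubst h p := by
  rw [retractX, aeval_rename, linSubst]
  rfl

theorem retractX_mem {h : (Fin 3 → k) →ₗ[k] (Fin 3 → k)} {p : PolyXY k s} {n : ℕ}
    (hp : p ∈ maxHomogIdeal (Fin 3 ⊕ Fin s) k ^ n) :
    retractX s h p ∈ idealOfVars (Fin 3) k ^ n := by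
  have h1 : maxHomogIdeal (Fin 3 ⊕ Fin s) k ≤ (idealOfVars (Fin 3) k).comap (retractX s h) := by
    rw [maxHomogIdeal_eq_idealOfVars, idealOfVars, Ideal.span_le]
    rintro _ ⟨i | j, rfl⟩
    · simpa [retractX] using linForm_mem _
    · simp [retractX]
  exact (Ideal.pow_right_mono h1 n).trans (Ideal.le_comap_pow _ n) hp

theorem ker_retractX {g h : (Fin 3 → k) →ₗ[k] (Fin 3 → k)} (hgh : g.comp h = LinearMap.id) :
    RingHom.ker (retractX s h) = idealY k s := by
  refine le_antisymm (fun p hp => ?_) ?_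
  · have key : ((Ideal.Quotient.mkₐ k (idealY k s)).comp
        ((rename Sum.inl).comp (linSubst g))).comp (retractX s h) =
        Ideal.Quotient.mkₐ k (idealY k s) := by
      refine algHom_ext fun i => ?_
      rcases i with i | j
      · have : retractX s h (X (Sum.inl i)) = linSubst h (X i) := by
          rw [← retractX_rename (s := s), rename_X]
        rw [AlgHom.comp_apply, this, AlgHom.comp_apply, AlgHom.comp_apply, linSubst_linSubst hgh,
          rename_X]
      · have : (X (Sum.inr j) : PolyXY k s) ∈ idealY k s := Ideal.subset_span ⟨j, rfl⟩
        have h0 : retractX s h (X (Sum.inr j)) = 0 := by simp [retractX]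
        rw [AlgHom.comp_apply, h0, map_zero]
        exact (Ideal.Quotient.eq_zero_iff_mem.2 this).symm
    have h1 := AlgHom.congr_fun key p
    rw [AlgHom.comp_apply, (RingHom.mem_ker (f := retractX s h)).1 hp, map_zero] at h1
    exact Ideal.Quotient.eq_zero_iff_mem.1 h1.symm
  · rw [idealY, Ideal.span_le]
    rintro _ ⟨j, rfl⟩
    simp [RingHom.mem_ker, retractX]

theorem map_rename_span (q : Fin 5 → MvPolynomial (Fin 3) k) :
    (Ideal.span (Set.range q)).map (rename (Sum.inl : Fin 3 → Fin 3 ⊕ Fin s)) = idealX s q := by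
  rw [idealX, Ideal.map_span, ← Set.range_comp]
  rfl

/-- If the socle of `P ⧸ B` is zero in degree one, the bilinear form which `ψ` induces on the
linear forms is nondegenerate: a form in its radical is a socle element of degree one. -/
theorem eq_zero_of_socle {q : Fin 5 → MvPolynomial (Fin 3) k} (hq : ∀ i, (q i).IsHomogeneous 2)
    {ψ : MvPolynomial (Fin 3) k →ₗ[k] k}
    (hψ : ∀ p, p.IsHomogeneous 2 → ψ p = 0 → p ∈ Submodule.span k (Set.range q))
    {B : Ideal (PolyXY k s)} (hB : B = idealX s q ⊔ idealY k s)
    (hsoc : ∀ x ∈ quotientSocle B, x ∈ quotientPiece B 1 → x = 0) (u : Fin 3 → k)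
    (hu : ∀ v, ψ (linForm u * linForm v) = 0) : u = 0 := by
  have hmem : rename Sum.inl (linForm u) ∈ B := by
    refine Ideal.Quotient.eq_zero_iff_mem.1 (hsoc _ (fun p hp => ?_)
      ⟨_, (linForm_isHomogeneous u).rename_isHomogeneous, rfl⟩)
    rw [← map_mul, Ideal.Quotient.eq_zero_iff_mem]
    have hle : maxHomogIdeal (Fin 3 ⊕ Fin s) k ≤
        B.colon {rename (Sum.inl : Fin 3 → Fin 3 ⊕ Fin s) (linForm u)} := by
      rw [maxHomogIdeal_eq_idealOfVars, idealOfVars, Ideal.span_le]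
      rintro _ ⟨i | j, rfl⟩
      · rw [SetLike.mem_coe, Submodule.mem_colon_singleton, smul_eq_mul, ← rename_X, ← map_mul,
          ← linForm_single, mul_comm, hB]
        refine Ideal.mem_sup_left ?_
        rw [← map_rename_span]
        refine Ideal.mem_map_of_mem _ (Submodule.span_le_restrictScalars k _ _ (hψ _ ?_ (hu _)))
        exact (linForm_isHomogeneous u).mul (linForm_isHomogeneous _)
      · rw [SetLike.mem_coe, Submodule.mem_colon_singleton, smul_eq_mul, hB]
        exact Ideal.mem_sup_right (Ideal.mul_mem_right _ _ (Ideal.subset_span ⟨j, rfl⟩))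
    exact Submodule.mem_colon_singleton.1 (hle hp)
  have hle : B ≤ (idealOfVars (Fin 3) k ^ 2).comap (retractX s LinearMap.id) := by
    rw [hB, sup_le_iff, idealX, Ideal.span_le,
      ← ker_retractX (g := LinearMap.id) (LinearMap.id_comp (LinearMap.id (M := Fin 3 → k)))]
    refine ⟨?_, fun p hp => ?_⟩
    · rintro _ ⟨i, rfl⟩
      rw [SetLike.mem_coe, Ideal.mem_comap, retractX_rename]
      exact isHomogeneous_two_mem_sq (linSubst_isHomogeneous _ (hq i))
    · rw [Ideal.mem_comap, (RingHom.mem_ker (f := retractX s LinearMap.id)).1 hp]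
      exact zero_mem _
  refine linForm_eq_zero_of_mem_sq ?_
  have := hle hmem
  rwa [Ideal.mem_comap, retractX_rename, linSubst_linForm, LinearMap.id_apply] at this

end XYVariables

theorem theorem0 (k : Type u) [Field k] (s : ℕ)
    (q : Fin 5 → MvPolynomial (Fin 3) k) (hq : ∀ i, (q i).IsHomogeneous 2)
    (hqind : LinearIndependent k q)
    (B' B A : Ideal (PolyXY k s)) (hB' : B' = idealX s q) (hB : B = B' ⊔ idealY k s)
    (hsoc : ∀ x ∈ quotientSocle B, x ∈ quotientPiece B 1 → x = 0)
    (hA : IsHomogIdeal A) (hA5 : A ≤ maxHomogIdeal (Fin 3 ⊕ Fin s) k ^ 5)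
    (hArt : IsArtinianRing (PolyXY k s ⧸ A)) (hGor : IsGorensteinLocalRing (PolyXY k s ⧸ A))
    (J : Ideal (PolyXY k s)) (hJ : J = A.colon (B : Set (PolyXY k s))) :
    ∃ (_ : IsLocalRing (PolyXY k s ⧸ J)) (_ : IsArtinianRing (PolyXY k s ⧸ J)),
      ∀ (ω : Type u) [AddCommGroup ω] [Module (PolyXY k s ⧸ J) ω],
        IsCanonicalModule (PolyXY k s ⧸ J) ω →
        ∀ (Z : Type u) [AddCommGroup Z] [Module (PolyXY k s ⧸ J) Z],
          IsSecondSyzygy (PolyXY k s ⧸ J) Z ω →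
          HasDirectSummandIso J Z (B' ⧸ (B • ⊤ : Submodule (PolyXY k s) B')) := by
  have hlocA := hGor.isLocalRing
  obtain ⟨ψ, hψq, hψ⟩ := exists_functional_of_quadratic_forms q hq hqind
  obtain ⟨g, t, a, c, ht, ha, hc, hgram⟩ := exists_linear_substitution ψ
    (eq_zero_of_socle hq hψ (hB' ▸ hB) hsoc)
  have hgh : g.toLinearMap.comp g.symm.toLinearMap = LinearMap.id := by ext; simp
  have hhg : g.symm.toLinearMap.comp g.toLinearMap = LinearMap.id := by ext; simp
  have hquad : (quadIdeal a c).map (linSubst g.toLinearMap) = Ideal.span (Set.range q) :=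
    map_quadIdeal_eq_span (ψ := t • ψ) ha hc hgh hq (fun i => by simp [hψq])
      (fun p hp h => hψ p hp ((mul_eq_zero.1 h).resolve_left ht)) hgram
  let ρ := retractX s g.symm.toLinearMap
  let σ : MvPolynomial (Fin 3) k →ₐ[k] PolyXY k s :=
    (rename Sum.inl).comp (linSubst g.toLinearMap)
  have hρσ (p) : ρ (σ p) = p := by
    change retractX s _ (rename Sum.inl (linSubst g.toLinearMap p)) = p
    rw [retractX_rename, linSubst_linSubst hhg]
  have hker : RingHom.ker ρ = idealY k s := ker_retractX hgh
  have hB'σ : B' = (quadIdeal a c).map σ := by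
    rw [hB', ← map_rename_span, ← hquad]
    exact Ideal.map_map (linSubst g.toLinearMap).toRingHom
      (rename (Sum.inl : Fin 3 → Fin 3 ⊕ Fin s)).toRingHom
  have hAρ : ∀ x ∈ A, ρ x ∈ idealOfVars (Fin 3) k ^ 5 := fun x hx => retractX_mem (hA5 hx)
  have hJ' (x) : x ∈ J ↔ ∀ b ∈ B, x * b ∈ A := by
    rw [hJ, Submodule.mem_colon]
    rfl
  have hAJ : A ≤ J := fun x hx => (hJ' x).2 fun b _ => A.mul_mem_right b hx
  have hJtop : J ≠ ⊤ := by
    intro h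
    -- otherwise `A` contains the quadric corresponding to `X₁ * X₂`
    have h1 : σ (quadForm a c 0) ∈ A := by
      have := (hJ' 1).1 (h ▸ Submodule.mem_top) (σ (quadForm a c 0))
        (hB ▸ Ideal.mem_sup_left (hB'σ ▸ Ideal.mem_map_of_mem σ (quadForm_mem a c 0)))
      rwa [one_mul] at this
    have h2 := hAρ _ h1
    rw [hρσ] at h2
    have h3 := coeffFun_eq_zero_of_mem_pow (l := 0) (m := 1) (n := 1) (by norm_num) h2
    have h4 : quadForm a c 0 = X 1 * (X 2 * C 1) := by simp [quadForm]
    rw [h4, coeffFun_X_one_mul, coeffFun_X_two_mul, coeffFun_C] at h3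
    simp at h3
  have := Ideal.Quotient.nontrivial_iff.2 hJtop
  have hsurj := Ideal.Quotient.factor_surjective hAJ
  have hloc : IsLocalRing (PolyXY k s ⧸ J) := IsLocalRing.of_surjective' _ hsurj
  refine ⟨hloc, hsurj.isArtinianRing, fun ω _ _ hω Z _ _ hZ => ?_⟩
  have := hsurj.isArtinianRing
  obtain ⟨φ, hφ, hφ'⟩ := exists_dual_functional A hGor
  have hAm : A ≤ idealOfVars (Fin 3 ⊕ Fin s) k := by
    rw [← maxHomogIdeal_eq_idealOfVars]
    exact hA5.trans (Ideal.pow_le_self (by norm_num))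
  exact hasDirectSummandIso_of_normal_form ρ σ hρσ ha hc (fun j => X (Sum.inr j)) hker.symm hB'σ
    (hker ▸ hB) hAρ φ hφ hφ' hJ' (exists_sub_algebraMap_mem_maximalIdeal hAJ hAm) hω hZ
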